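/- Let $m\in(1,\infty)$ and $\lambda>0$. Let $\mathcal G$ be the random rooted tree (with root $\rho$) generated by a branching process in which the numbers of offspring of the individuals are i.i.d. random variables with mean $m$. Let $\mathbf X=(X_k)_{k\ge 0}$ be the $\lambda$-biased random walk on $\mathcal G$: $X_0=\rho$ and, conditionally on $\mathcal G$, $\mathbf X$ is a Markov chain on the vertices of $\mathcal G$ with the following transitions. From a vertex $\nu\neq\rho$ with $s\ge 0$ children it jumps to the parent of $\nu$ with probability $\lambda/(\lambda+s)$ and to each given child of $\nu$ with probability $1/(\lambda+s)$. If $\rho$ has $s\ge1$ children, then from $\rho$ it jumps to each given child with probability $1/s$; if $\rho$ has no children, it stays at $\rho$. Let $\tau=\inf\{j\ge1: X_j=\rho\}$ (with $\inf\emptyset=\infty$), and let $\mathbf P$, $\mathbf E$ be the probability and the expectation over both the tree and the walk. Then: (i) if $0<\lambda<m$, the walk is transient, that is, $\mathbf P(\tau=\infty)>0$; (ii) if $\lambda>m$, the walk is positive recurrent, that is, $\mathbf P(\tau=\infty)=0$ and $\mathbf E[\tau]<\infty$. -/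

import Mathlib

open MeasureTheory ProbabilityTheory
open scoped ENNReal

noncomputable section

namespace BiasedWalk

/-- Vertices of the universal (Ulam-Harris) tree. The root is `[]`, the potential children of `v`
are the lists `i :: v`, and the parent of `i :: v` is `v`. -/
abbrev Vertex : Type := List ℕ

namespace Vertex

/-- The root `ρ`. -/
abbrev root : Vertex := []

/-- The `i`-th potential child of `v`. -/
abbrev child (v : Vertex) (i : ℕ) : Vertex := i :: v

/-- `w` is one of the potential children of `v` (equivalently, `w` is not the root and `v` is
the parent of `w`). -/
def IsChild (v w : Vertex) : Prop := ∃ i : ℕ, w = v.child i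

end Vertex

/-- Every set of vertices is measurable. -/
instance : MeasurableSpace Vertex := ⊤

/-- `v` is a vertex of the family tree in which each individual `u` has `z u` children
`u.child 0, …, u.child (z u - 1)`. -/
def IsInTree (z : Vertex → ℕ) : Vertex → Prop
  | [] => True
  | i :: v => IsInTree z v ∧ i < z v

/-- The vertex set of the family tree generated by the offspring numbers `z`. -/
def familyTree (z : Vertex → ℕ) : Set Vertex := {v | IsInTree z v}

/-- The number of children of `v` in the tree with vertex set `T`. -/
def numChildren (T : Set Vertex) (v : Vertex) : ℕ := {w | w ∈ T ∧ v.IsChild w}.ncard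

open Classical in
/-- One-step transition probabilities of the `lam`-biased random walk on the tree `T`. -/
def stepProb (lam : ℝ) (T : Set Vertex) : Vertex → Vertex → ℝ
  | [], w =>
      if numChildren T Vertex.root = 0 then
        if w = Vertex.root then 1 else 0
      else if w ∈ T ∧ Vertex.root.IsChild w then 1 / (numChildren T Vertex.root : ℝ)
      else 0
  | i :: u, w =>
      if w = u then lam / (lam + numChildren T (Vertex.child u i))
      else if w ∈ T ∧ (Vertex.child u i).IsChild w then
        1 / (lam + numChildren T (Vertex.child u i))
      else 0

variable {Ω : Type*} [MeasurableSpace Ω]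

/-- The offspring numbers `Z v` are independent and identically distributed, with finite
mean `m`. -/
structure IsOffspringFamily (P : Measure Ω) (Z : Vertex → Ω → ℕ) (m : ℝ) : Prop where
  measurable : ∀ v, Measurable (Z v)
  indep : iIndepFun Z P
  identDistrib : ∀ v, IdentDistrib (Z v) (Z Vertex.root) P P
  integrable : Integrable (fun ω => (Z Vertex.root ω : ℝ)) P
  mean : ∫ ω, (Z Vertex.root ω : ℝ) ∂P = m

/-- The random (Galton-Watson) tree generated by the offspring numbers `Z`. -/
def randomTree (Z : Vertex → Ω → ℕ) (ω : Ω) : Set Vertex := familyTree (fun v => Z v ω)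

/-- The information given by the random tree `G` and by `X 0, …, X n`. -/
@[reducible] def history (G : Ω → Set Vertex) (X : ℕ → Ω → Vertex) (n : ℕ) : MeasurableSpace Ω :=
  (⨆ v : Vertex, MeasurableSpace.generateFrom {{ω | v ∈ G ω}}) ⊔
    ⨆ j : ℕ, ⨆ _ : j ≤ n, MeasurableSpace.comap (X j) inferInstance

/-- `X` is the `lam`-biased random walk on the random tree `G`: it starts at the root and,
conditionally on `G`, it is a Markov chain with transition probabilities `stepProb lam G`. -/
structure IsBiasedWalk (P : Measure Ω) (lam : ℝ) (G : Ω → Set Vertex) (X : ℕ → Ω → Vertex) :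
    Prop where
  measurable : ∀ n, Measurable (X n)
  start : ∀ᵐ ω ∂P, X 0 ω = Vertex.root
  step : ∀ (n : ℕ) (w : Vertex),
    P[Set.indicator {ω | X (n + 1) ω = w} (fun _ => (1 : ℝ)) | history G X n]
      =ᵐ[P] fun ω => stepProb lam (G ω) (X n ω) w

/-- The time `τ = inf {j ≥ 1 : X j = ρ}` of the first return to the root (`⊤` if there is
no return). -/
def returnTime (X : ℕ → Ω → Vertex) (ω : Ω) : ℕ∞ :=
  ⨅ j : ℕ, ⨅ _ : 1 ≤ j ∧ X j ω = Vertex.root, (j : ℕ∞)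

/-- With positive probability the process does not return to the root. -/
def IsTransient (P : Measure Ω) (X : ℕ → Ω → Vertex) : Prop :=
  0 < P {ω | returnTime X ω = ⊤}

/-- The process is recurrent (not transient), and the time of the first return to the root has
finite expectation. -/
def IsPositiveRecurrent (P : Measure Ω) (X : ℕ → Ω → Vertex) : Prop :=
  ¬ IsTransient P X ∧ ∫⁻ ω, (returnTime X ω : ℝ≥0∞) ∂P < ∞

end BiasedWalk

end

/-!
Everything is integrated against nonnegative functions of the tree and of the past of the walk, so
that no regular conditional distribution given the tree is needed; in this form the Markov property
is `lintegral_step`. The event that the return time exceeds `k` is `awayUpTo X k`.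

For `m < lam`, the reversible measure of the walk dominates the expected numbers of visits before
the return to the root (`sum_lintegral_visits_le`). This is an induction on time which uses only
that the measure is superinvariant off the root, and in particular does not presuppose recurrence.
Level `n` has conditional mass of order `lam ^ (-n)` times the sizes of generations `n` and `n + 1`,
whose means are powers of `m`. The total expected mass is a convergent geometric series, and it
bounds the expected return time.

For `lam < m`, the offspring numbers are truncated at a level `N` for which their mean `M` still
exceeds `max 1 lam`. Only the flow is truncated, not the walk. On the first `n` generations the flow
that splits evenly among the truncated descendants in generation `n` has, by a second moment
computation, an expected energy comparable with the square of its expected strength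
(`lintegral_flowEnergy_le`): the contribution of the `k`-th generation is of order `(lam / M) ^ k`.
The bound `strength ^ 2 / energy` of Thomson's principle satisfies, by the Cauchy–Schwarz
inequality, the series and parallel laws with an inequality (`escapeBound_succ_mul_le`), and so
yields a subharmonic function `climbBound` with values in `[0, 1]` which vanishes at the root. Its
values along the walk bound from below the probability of not having returned by time `n`
(`lintegral_le_measure_awayUpTo`), and its expectation after one step is bounded away from zero
uniformly in `n`.
-/

open MeasureTheory ProbabilityTheory
open scoped ENNReal NNReal

namespace BiasedWalk

/-! ### Family trees and transition probabilities -/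

theorem cons_mem_familyTree {z : Vertex → ℕ} {i : ℕ} {v : Vertex} :
    i :: v ∈ familyTree z ↔ v ∈ familyTree z ∧ i < z v := Iff.rfl

theorem numChildren_of_mem {z : Vertex → ℕ} {v : Vertex} (hv : v ∈ familyTree z) :
    numChildren (familyTree z) v = z v := by
  have h : {w | w ∈ familyTree z ∧ v.IsChild w} =
      (fun i : ℕ => (i :: v : Vertex)) '' (Finset.range (z v) : Set ℕ) := by
    ext w
    constructor
    · rintro ⟨hw, i, rfl⟩
      exact ⟨i, by simpa using (cons_mem_familyTree.1 hw).2, rfl⟩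
    · rintro ⟨i, hi, rfl⟩
      exact ⟨cons_mem_familyTree.2 ⟨hv, by simpa using hi⟩, i, rfl⟩
  rw [numChildren, h, Set.ncard_image_of_injective _ (fun a b hab => (List.cons.inj hab).1),
    Set.ncard_coe_finset, Finset.card_range]

theorem numChildren_of_notMem {z : Vertex → ℕ} {v : Vertex} (hv : v ∉ familyTree z) :
    numChildren (familyTree z) v = 0 := by
  have h : {w | w ∈ familyTree z ∧ v.IsChild w} = ∅ := by
    ext w
    simp only [Set.mem_ofPred_eq, Set.mem_empty_iff_false, iff_false]
    rintro ⟨hw, i, rfl⟩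
    exact hv (cons_mem_familyTree.1 hw).1
  rw [numChildren, h, Set.ncard_empty]

/-- Membership in a family tree is determined by its child counts alone, including at vertices
whose parent is not in the tree. -/
theorem cons_mem_iff_lt_numChildren {z : Vertex → ℕ} {i : ℕ} {v : Vertex} :
    i :: v ∈ familyTree z ↔ i < numChildren (familyTree z) v := by
  by_cases hv : v ∈ familyTree z
  · rw [numChildren_of_mem hv, cons_mem_familyTree]
    exact and_iff_right hv
  · rw [numChildren_of_notMem hv, cons_mem_familyTree]
    simp [hv]

theorem isChild_cons_iff {u v : Vertex} {i : ℕ} : u.IsChild (i :: v) ↔ u = v := by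
  constructor
  · rintro ⟨j, hj⟩
    exact (List.cons.inj hj).2.symm
  · rintro rfl
    exact ⟨i, rfl⟩

theorem stepProb_nonneg {lam : ℝ} (hlam : 0 ≤ lam) (T : Set Vertex) (v w : Vertex) :
    0 ≤ stepProb lam T v w := by
  cases v with
  | nil => unfold stepProb; split_ifs <;> positivity
  | cons i u => unfold stepProb; split_ifs <;> positivity

theorem stepProb_parent (lam : ℝ) (T : Set Vertex) (i : ℕ) (u : Vertex) :
    stepProb lam T (i :: u) u = lam / (lam + numChildren T (i :: u)) := by
  simp [stepProb]

theorem cons_cons_ne (i j : ℕ) (u : Vertex) : (j :: i :: u : Vertex) ≠ u := by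
  intro h
  have := congrArg List.length h
  simp at this
  omega

theorem stepProb_child (lam : ℝ) {T : Set Vertex} {i j : ℕ} {u : Vertex}
    (h : j :: i :: u ∈ T) :
    stepProb lam T (i :: u) (j :: i :: u) = 1 / (lam + numChildren T (i :: u)) := by
  rw [stepProb, if_neg (cons_cons_ne i j u), if_pos ⟨h, isChild_cons_iff.2 rfl⟩]

theorem stepProb_root_child (lam : ℝ) {z : Vertex → ℕ} {j : ℕ} (h : [j] ∈ familyTree z) :
    stepProb lam (familyTree z) [] [j] = 1 / (numChildren (familyTree z) [] : ℝ) := by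
  have h' := cons_mem_iff_lt_numChildren.1 h
  rw [stepProb, if_neg (by simp only [Vertex.root]; omega),
    if_pos ⟨h, isChild_cons_iff.2 rfl⟩]

/-- A vertex other than the root can be entered only from its parent, if it is in the tree, or
from one of its potential children. -/
theorem stepProb_cons_eq_zero (lam : ℝ) {T : Set Vertex} {v u : Vertex} {i : ℕ}
    (h : v = u → i :: u ∉ T) (h' : ∀ a, v ≠ a :: i :: u) :
    stepProb lam T v (i :: u) = 0 := by
  cases v with
  | nil =>
    have : ¬ (i :: u ∈ T ∧ Vertex.root.IsChild (i :: u)) := by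
      rintro ⟨h1, h2⟩
      exact h (isChild_cons_iff.1 h2) h1
    simp only [stepProb, if_neg this]
    simp
  | cons a v =>
    rw [stepProb, if_neg, if_neg]
    · rintro ⟨h1, h2⟩
      exact h (isChild_cons_iff.1 h2) h1
    · rintro rfl
      exact h' a rfl

/-! ### Measurability of the random tree -/

section Measurability

variable {Ω : Type*} [MeasurableSpace Ω] {Z : Vertex → Ω → ℕ}

theorem measurableSet_mem_randomTree (hZ : ∀ v, Measurable (Z v)) (v : Vertex) :
    MeasurableSet {ω | v ∈ randomTree Z ω} := by
  induction v with
  | nil => exact MeasurableSet.univ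
  | cons i v ih => exact ih.inter (measurableSet_lt measurable_const (hZ v))

theorem measurable_numChildren (h : ∀ v, MeasurableSet {ω | v ∈ randomTree Z ω}) (v : Vertex) :
    Measurable fun ω => numChildren (randomTree Z ω) v := by
  refine measurable_of_Ioi fun i => ?_
  convert h (i :: v) using 1
  ext ω
  exact cons_mem_iff_lt_numChildren.symm

theorem measurable_stepProb (lam : ℝ) (h : ∀ v, MeasurableSet {ω | v ∈ randomTree Z ω})
    (v w : Vertex) : Measurable fun ω => stepProb lam (randomTree Z ω) v w := by
  have hy := fun v => measurable_numChildren h v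
  have hr : ∀ v, Measurable fun ω => (numChildren (randomTree Z ω) v : ℝ) := fun v =>
    measurable_from_top.comp (hy v)
  cases v with
  | nil =>
    unfold stepProb
    refine Measurable.ite (hy [] (measurableSet_singleton 0)) measurable_const ?_
    refine Measurable.ite ((h w).inter (MeasurableSet.const _)) ?_ measurable_const
    exact (hr []).const_div 1
  | cons i u =>
    unfold stepProb
    refine Measurable.ite (MeasurableSet.const _) ?_ ?_
    · exact ((hr _).const_add lam).const_div lam
    · refine Measurable.ite ((h w).inter (MeasurableSet.const _)) ?_ measurable_const
      exact ((hr _).const_add lam).const_div 1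

end Measurability

/-! ### The Markov property and excursions from the root -/

section Markov

variable {Ω : Type*}

/-- The information given by the random tree `G` alone. -/
@[reducible] def treeInfo (G : Ω → Set Vertex) : MeasurableSpace Ω :=
  ⨆ v : Vertex, MeasurableSpace.generateFrom {{ω | v ∈ G ω}}

theorem measurableSet_treeInfo (G : Ω → Set Vertex) (v : Vertex) :
    MeasurableSet[treeInfo G] {ω | v ∈ G ω} :=
  le_iSup (fun v : Vertex => MeasurableSpace.generateFrom {{ω | v ∈ G ω}}) v _
    (MeasurableSpace.measurableSet_generateFrom rfl)

theorem treeInfo_le_history (G : Ω → Set Vertex) (X : ℕ → Ω → Vertex) (n : ℕ) :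
    treeInfo G ≤ history G X n := le_sup_left

theorem measurableSet_history {G : Ω → Set Vertex} {X : ℕ → Ω → Vertex} {j n : ℕ} (hj : j ≤ n)
    (s : Set Vertex) : MeasurableSet[history G X n] {ω | X j ω ∈ s} := by
  have h : MeasurableSpace.comap (X j) inferInstance ≤ history G X n :=
    (le_iSup₂ (f := fun j (_ : j ≤ n) => MeasurableSpace.comap (X j) inferInstance) j hj).trans
      le_sup_right
  exact h _ ⟨s, trivial, rfl⟩

/-- The event that the walk stays away from the root at the times `1, …, k`, that is, that the
return time exceeds `k`. -/
def awayUpTo (X : ℕ → Ω → Vertex) (k : ℕ) : Set Ω := {ω | ∀ j, 1 ≤ j → j ≤ k → X j ω ≠ []}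

theorem awayUpTo_eq_iInter (X : ℕ → Ω → Vertex) (k : ℕ) :
    awayUpTo X k = ⋂ j : ℕ, {ω | 1 ≤ j → j ≤ k → X j ω ≠ []} := by
  ext ω; simp [awayUpTo]

theorem awayUpTo_zero (X : ℕ → Ω → Vertex) : awayUpTo X 0 = Set.univ := by
  ext ω
  simp only [awayUpTo, Set.mem_ofPred_eq, Set.mem_univ, iff_true]
  omega

theorem mem_awayUpTo_succ {X : ℕ → Ω → Vertex} {k : ℕ} {ω : Ω} :
    ω ∈ awayUpTo X (k + 1) ↔ ω ∈ awayUpTo X k ∧ X (k + 1) ω ≠ [] := by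
  constructor
  · exact fun h => ⟨fun j h1 h2 => h j h1 (by omega), h _ (by omega) le_rfl⟩
  · rintro ⟨h, h'⟩ j h1 h2
    rcases Nat.lt_or_ge k j with hj | hj
    · obtain rfl : j = k + 1 := by omega
      exact h'
    · exact h j h1 hj

theorem awayUpTo_antitone (X : ℕ → Ω → Vertex) : Antitone (awayUpTo X) :=
  fun _ _ h _ hω j h1 h2 => hω j h1 (h2.trans h)

theorem measurableSet_awayUpTo (G : Ω → Set Vertex) (X : ℕ → Ω → Vertex) (k : ℕ) :
    MeasurableSet[history G X k] (awayUpTo X k) := by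
  rw [awayUpTo_eq_iInter]
  refine MeasurableSet.iInter fun j => ?_
  by_cases h1 : 1 ≤ j
  · by_cases h2 : j ≤ k
    · simpa [h1, h2] using (measurableSet_history (G := G) (X := X) h2 {w | w ≠ []})
    · simp [h2]
  · simp [h1]

theorem returnTime_eq_top_iff {X : ℕ → Ω → Vertex} {ω : Ω} :
    returnTime X ω = ⊤ ↔ ∀ k, ω ∈ awayUpTo X k := by
  simp only [returnTime, iInf_eq_top, ENat.natCast_ne_top, imp_false, not_and, awayUpTo,
    Set.mem_ofPred_eq]
  exact ⟨fun h k j h1 _ => h j h1, fun h j h1 => h j j h1 le_rfl⟩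

open Classical in
/-- The return time is at most the number of times `k ≥ 0` at which the walk has not yet
returned. -/
theorem returnTime_le_tsum (X : ℕ → Ω → Vertex) (ω : Ω) :
    (returnTime X ω : ℝ≥0∞) ≤ ∑' k, (awayUpTo X k).indicator 1 ω := by
  by_cases h : ∀ k, ω ∈ awayUpTo X k
  · have : ∀ k, (awayUpTo X k).indicator (1 : Ω → ℝ≥0∞) ω = 1 := fun k => by simp [h k]
    simp [this]
  · push Not at h
    have hk := Nat.find_spec h
    set k := Nat.find h with hkdef
    have hlt : ∀ j < k, ω ∈ awayUpTo X j := fun j hj => not_not.1 (Nat.find_min h hj)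
    obtain ⟨k', hk'⟩ : ∃ k', k = k' + 1 := by
      refine Nat.exists_eq_add_one.2 (Nat.pos_of_ne_zero fun h0 => hk ?_)
      rw [h0, awayUpTo_zero]; trivial
    have hX : X k ω = [] := by
      rw [hk'] at hk ⊢
      by_contra hne
      exact hk (mem_awayUpTo_succ.2 ⟨hlt k' (by omega), hne⟩)
    have hle : returnTime X ω ≤ (k : ℕ∞) := iInf₂_le k ⟨by omega, hX⟩
    calc (returnTime X ω : ℝ≥0∞) ≤ ((k : ℕ∞) : ℝ≥0∞) := ENat.toENNReal_le.2 hle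
      _ = ∑ j ∈ Finset.range k, (awayUpTo X j).indicator (1 : Ω → ℝ≥0∞) ω := by
        rw [Finset.sum_congr rfl (g := fun _ => 1)]
        · simp
        · intro j hj
          simp [hlt j (Finset.mem_range.1 hj)]
      _ ≤ _ := ENNReal.sum_le_tsum _

variable [mΩ : MeasurableSpace Ω] {P : Measure Ω} {lam : ℝ} {Z : Vertex → Ω → ℕ}
  {X : ℕ → Ω → Vertex}

theorem treeInfo_le (h : ∀ v, MeasurableSet {ω | v ∈ randomTree Z ω}) :
    treeInfo (randomTree Z) ≤ mΩ :=
  iSup_le fun v => MeasurableSpace.generateFrom_le (by rintro _ rfl; exact h v)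

theorem history_le (h : ∀ v, MeasurableSet {ω | v ∈ randomTree Z ω})
    (hX : IsBiasedWalk P lam (randomTree Z) X) (n : ℕ) : history (randomTree Z) X n ≤ mΩ :=
  sup_le (treeInfo_le h) (iSup₂_le fun j _ => (hX.measurable j).comap_le)

theorem aemeasurable_stepProb (h : ∀ v, MeasurableSet {ω | v ∈ randomTree Z ω})
    (hX : IsBiasedWalk P lam (randomTree Z) X) (n : ℕ) (w : Vertex) :
    AEMeasurable (fun ω => ENNReal.ofReal (stepProb lam (randomTree Z ω) (X n ω) w)) P :=
  (((stronglyMeasurable_condExp.mono (history_le h hX n)).measurable.aemeasurable).congr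
    (hX.step n w)).ennreal_ofReal

variable [IsProbabilityMeasure P]

/-- The defining property of the conditional transition probabilities, extended from indicators
to nonnegative functions of the history. -/
theorem lintegral_indicator_step (hlam : 0 ≤ lam)
    (h : ∀ v, MeasurableSet {ω | v ∈ randomTree Z ω})
    (hX : IsBiasedWalk P lam (randomTree Z) X) (n : ℕ) (w : Vertex) {F : Ω → ℝ≥0∞}
    (hF : Measurable[history (randomTree Z) X n] F) :
    ∫⁻ ω, {ω | X (n + 1) ω = w}.indicator F ω ∂P =
      ∫⁻ ω, ENNReal.ofReal (stepProb lam (randomTree Z ω) (X n ω) w) * F ω ∂P := by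
  have hm := history_le h hX n
  set B : Set Ω := {ω | X (n + 1) ω = w} with hB
  have hBm : MeasurableSet B := hX.measurable (n + 1) (MeasurableSet.of_discrete (s := {w}))
  set f : Ω → ℝ := P[B.indicator (fun _ => (1 : ℝ)) | history (randomTree Z) X n] with hf
  have hfs : f =ᵐ[P] fun ω => stepProb lam (randomTree Z ω) (X n ω) w := hX.step n w
  have hf0 : 0 ≤ᵐ[P] f := by
    filter_upwards [hfs] with ω hω
    rw [hω]
    exact stepProb_nonneg hlam _ _ _
  have hfm : Measurable f := (stronglyMeasurable_condExp.mono hm).measurable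
  have key : (P.restrict B).trim hm =
      (P.withDensity fun ω => ENNReal.ofReal (f ω)).trim hm := by
    refine @Measure.ext _ (history (randomTree Z) X n) _ _ fun s hs => ?_
    rw [trim_measurableSet_eq hm hs, trim_measurableSet_eq hm hs,
      Measure.restrict_apply (hm _ hs), withDensity_apply _ (hm _ hs),
      ← ofReal_integral_eq_lintegral_ofReal integrable_condExp.integrableOn
        (ae_restrict_of_ae hf0),
      setIntegral_condExp hm ((integrable_const _).indicator hBm) hs,
      integral_indicator hBm, Measure.restrict_restrict hBm]
    simp [Set.inter_comm]
  calc ∫⁻ ω, B.indicator F ω ∂P = ∫⁻ ω, F ω ∂(P.restrict B) := lintegral_indicator hBm F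
    _ = ∫⁻ ω, F ω ∂(P.withDensity fun ω => ENNReal.ofReal (f ω)) := by
        rw [← lintegral_trim hm hF, key, lintegral_trim hm hF]
    _ = ∫⁻ ω, ENNReal.ofReal (f ω) * F ω ∂P :=
        lintegral_withDensity_eq_lintegral_mul _ hfm.ennreal_ofReal (hF.mono hm le_rfl)
    _ = _ := by
        refine lintegral_congr_ae ?_
        filter_upwards [hfs] with ω hω
        rw [hω]

/-- The Markov property: `φ w` may depend on the tree and on the past. -/
theorem lintegral_step (hlam : 0 ≤ lam) (h : ∀ v, MeasurableSet {ω | v ∈ randomTree Z ω})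
    (hX : IsBiasedWalk P lam (randomTree Z) X) (n : ℕ) {φ : Vertex → Ω → ℝ≥0∞}
    (hφ : ∀ w, Measurable[history (randomTree Z) X n] (φ w)) :
    ∫⁻ ω, φ (X (n + 1) ω) ω ∂P =
      ∫⁻ ω, ∑' w, ENNReal.ofReal (stepProb lam (randomTree Z ω) (X n ω) w) * φ w ω ∂P := by
  have hm := history_le h hX n
  have h1 : ∀ ω, φ (X (n + 1) ω) ω = ∑' w, {ω | X (n + 1) ω = w}.indicator (φ w) ω := by
    intro ω
    rw [tsum_eq_single (X (n + 1) ω)]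
    · exact (Set.indicator_of_mem (s := {ω' | X (n + 1) ω' = X (n + 1) ω}) rfl _).symm
    · intro w hw
      exact Set.indicator_of_notMem (s := {ω | X (n + 1) ω = w}) (fun h' => hw h'.symm) _
  simp_rw [h1]
  rw [lintegral_tsum, lintegral_tsum]
  · exact tsum_congr fun w => lintegral_indicator_step hlam h hX n w (hφ w)
  · exact fun w => (aemeasurable_stepProb h hX n w).mul ((hφ w).mono hm le_rfl).aemeasurable
  · intro w
    have hB : MeasurableSet {ω | X (n + 1) ω = w} :=
      hX.measurable (n + 1) (MeasurableSet.of_discrete (s := {w}))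
    exact (((hφ w).mono hm le_rfl).indicator hB).aemeasurable

end Markov

/-! ### Independence of disjoint parts of the offspring family -/

section Offspring

variable {Ω : Type*}

/-- The information given by the offspring numbers of the vertices in `S`. -/
@[reducible] def offspringInfo (Z : Vertex → Ω → ℕ) (S : Set Vertex) : MeasurableSpace Ω :=
  ⨆ v ∈ S, MeasurableSpace.comap (Z v) inferInstance

theorem offspringInfo_mono (Z : Vertex → Ω → ℕ) {S S' : Set Vertex} (h : S ⊆ S') :
    offspringInfo Z S ≤ offspringInfo Z S' :=
  biSup_mono h

theorem measurable_offspringInfo (Z : Vertex → Ω → ℕ) {S : Set Vertex} {v : Vertex} (hv : v ∈ S) :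
    Measurable[offspringInfo Z S] (Z v) := by
  intro s hs
  exact le_iSup₂ (f := fun v (_ : v ∈ S) => MeasurableSpace.comap (Z v) inferInstance) v hv _
    ⟨s, hs, rfl⟩

/-- Whether `v` belongs to the tree depends only on the offspring numbers of the vertices closer
to the root than `v`. -/
theorem measurableSet_mem_offspringInfo (Z : Vertex → Ω → ℕ) (v : Vertex) :
    MeasurableSet[offspringInfo Z {u | u.length < v.length}] {ω | v ∈ randomTree Z ω} := by
  induction v with
  | nil => exact MeasurableSet.univ
  | cons i v ih =>
    refine MeasurableSet.inter (offspringInfo_mono Z ?_ _ ih) ?_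
    · intro u hu
      simp only [List.length_cons, Set.mem_ofPred_eq] at hu ⊢
      omega
    · exact measurable_offspringInfo Z (v := v) (by simp) (measurableSet_Ioi (a := i))

theorem measurable_indicator_one {mΩ : MeasurableSpace Ω} {s : Set Ω} (hs : MeasurableSet s) :
    Measurable (s.indicator (1 : Ω → ℝ≥0∞)) :=
  measurable_one.indicator hs

variable [mΩ : MeasurableSpace Ω] {P : Measure Ω} {Z : Vertex → Ω → ℕ} {m : ℝ}

theorem offspringInfo_le (hZ : ∀ v, Measurable (Z v)) (S : Set Vertex) :
    offspringInfo Z S ≤ mΩ :=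
  iSup₂_le fun v _ => (hZ v).comap_le

theorem lintegral_mul_of_disjoint (hZ : IsOffspringFamily P Z m) {S S' : Set Vertex}
    (hS : Disjoint S S') {f g : Ω → ℝ≥0∞} (hf : Measurable[offspringInfo Z S] f)
    (hg : Measurable[offspringInfo Z S'] g) :
    ∫⁻ ω, f ω * g ω ∂P = (∫⁻ ω, f ω ∂P) * ∫⁻ ω, g ω ∂P :=
  lintegral_mul_eq_lintegral_mul_lintegral_of_independent_measurableSpace
    (offspringInfo_le hZ.measurable S) (offspringInfo_le hZ.measurable S')
    (indep_iSup_of_disjoint (fun v => (hZ.measurable v).comap_le) hZ.indep hS) hf hg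

theorem lintegral_offspring (hZ : IsOffspringFamily P Z m) (v : Vertex) :
    ∫⁻ ω, (Z v ω : ℝ≥0∞) ∂P = ENNReal.ofReal m := by
  have h1 := ((hZ.identDistrib v).comp (u := fun k : ℕ => (k : ℝ≥0∞))
    measurable_from_top).lintegral_eq
  have h2 := ofReal_integral_eq_lintegral_ofReal hZ.integrable (by
    filter_upwards with ω using Nat.cast_nonneg _)
  rw [hZ.mean] at h2
  rw [h2]
  simpa using h1

theorem measure_lt_offspring (hZ : IsOffspringFamily P Z m) (v : Vertex) (i : ℕ) :
    P {ω | i < Z v ω} = P {ω | i < Z [] ω} :=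
  (hZ.identDistrib v).measure_mem_eq (measurableSet_Ioi (a := i))

theorem measurableSet_lt_offspring (hZ : IsOffspringFamily P Z m) (v : Vertex) (i : ℕ) :
    MeasurableSet {ω | i < Z v ω} := hZ.measurable v (measurableSet_Ioi (a := i))

theorem tsum_measure_lt_offspring (hZ : IsOffspringFamily P Z m) (v : Vertex) :
    ∑' i, P {ω | i < Z v ω} = ENNReal.ofReal m := by
  rw [← lintegral_offspring hZ v]
  simp_rw [← lintegral_indicator_one (measurableSet_lt_offspring hZ v _)]
  rw [← lintegral_tsum fun i =>
    (measurable_indicator_one (measurableSet_lt_offspring hZ v i)).aemeasurable]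
  refine lintegral_congr fun ω => ?_
  rw [tsum_eq_sum (s := Finset.range (Z v ω))]
  · rw [Finset.sum_congr rfl (g := fun _ => 1)]
    · simp
    · intro i hi
      exact Set.indicator_of_mem (s := {ω | i < Z v ω}) (Finset.mem_range.1 hi) _
  · intro i hi
    exact Set.indicator_of_notMem (s := {ω | i < Z v ω}) (by simpa using hi) _

theorem measure_cons_mem (hZ : IsOffspringFamily P Z m) (i : ℕ) (v : Vertex) :
    P {ω | i :: v ∈ randomTree Z ω} = P {ω | v ∈ randomTree Z ω} * P {ω | i < Z v ω} := by
  have h1 := measurableSet_mem_randomTree hZ.measurable v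
  have h2 := measurableSet_lt_offspring hZ v i
  have hd : Disjoint {u : Vertex | u.length < v.length} {v} := by
    rw [Set.disjoint_singleton_right]; simp
  have := lintegral_mul_of_disjoint hZ hd
    (measurable_indicator_one (measurableSet_mem_offspringInfo Z v))
    (measurable_indicator_one
      (measurable_offspringInfo Z (S := {v}) rfl (measurableSet_Ioi (a := i))))
  have e : Z v ⁻¹' Set.Ioi i = {ω | i < Z v ω} := rfl
  rw [e, lintegral_indicator_one h1, lintegral_indicator_one h2] at this
  rw [← this, ← lintegral_indicator_one (measurableSet_mem_randomTree hZ.measurable (i :: v))]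
  refine lintegral_congr fun ω => ?_
  rw [← Set.inter_indicator_mul]
  simp only [Pi.one_apply, mul_one]
  rfl

end Offspring

/-! ### Sums over the levels of the tree -/

/-- The sum of `f` over the vertices at distance `n` from the root. -/
noncomputable def levelSum (f : Vertex → ℝ≥0∞) (n : ℕ) : ℝ≥0∞ :=
  ∑' v, if v.length = n then f v else 0

theorem tsum_levelSum (f : Vertex → ℝ≥0∞) : ∑' n, levelSum f n = ∑' v, f v := by
  unfold levelSum
  rw [ENNReal.tsum_comm]
  exact tsum_congr fun v => by rw [tsum_eq_single v.length] <;> simp +contextual [eq_comm]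

theorem levelSum_zero (f : Vertex → ℝ≥0∞) : levelSum f 0 = f [] := by
  unfold levelSum
  rw [tsum_eq_single []] <;> simp +contextual

theorem levelSum_succ (f : Vertex → ℝ≥0∞) (n : ℕ) :
    levelSum f (n + 1) = levelSum (fun v => ∑' i, f (i :: v)) n := by
  unfold levelSum
  have hinj : Function.Injective fun p : Vertex × ℕ => (p.2 :: p.1 : Vertex) := by
    rintro ⟨v, i⟩ ⟨w, j⟩ h
    obtain ⟨h1, h2⟩ := List.cons.inj h
    exact Prod.ext h2 h1
  rw [← hinj.tsum_eq,
    ENNReal.tsum_prod (f := fun v i => if (i :: v : Vertex).length = n + 1 then f (i :: v) else 0)]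
  · refine tsum_congr fun v => ?_
    by_cases hv : v.length = n <;> simp [hv]
  · intro v hv
    cases v with
    | nil => simp at hv
    | cons i v => exact ⟨(v, i), rfl⟩

theorem levelSum_mono {f g : Vertex → ℝ≥0∞} {n : ℕ} (h : ∀ v, v.length = n → f v ≤ g v) :
    levelSum f n ≤ levelSum g n :=
  ENNReal.tsum_le_tsum fun v => by split_ifs with hv; exacts [h v hv, le_rfl]

theorem levelSum_mul_right (f : Vertex → ℝ≥0∞) (n : ℕ) (c : ℝ≥0∞) :
    levelSum (fun v => f v * c) n = levelSum f n * c := by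
  unfold levelSum
  rw [← ENNReal.tsum_mul_right]
  exact tsum_congr fun v => by split_ifs <;> simp

/-! ### Strong bias: positive recurrence -/

section Recurrence

/-- The reversible measure of the biased walk on the tree `T`, for the conductances `lam ^ (-n)` of
the edges between the levels `n` and `n + 1`, except that the mass of the root is replaced by `1`.
It is superinvariant off the root. -/
noncomputable def visitBound (lam : ℝ) (T : Set Vertex) (v : Vertex) : ℝ≥0∞ :=
  open Classical in
  if v = [] then 1 else if v ∈ T then ENNReal.ofReal ((lam + numChildren T v) / lam ^ v.length)
    else 0

theorem visitBound_mul_stepProb_child_le {lam : ℝ} (hlam : 0 < lam) {z : Vertex → ℕ} {i : ℕ}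
    {v : Vertex} (h : i :: v ∈ familyTree z) :
    visitBound lam (familyTree z) v * ENNReal.ofReal (stepProb lam (familyTree z) v (i :: v)) ≤
      ENNReal.ofReal (1 / lam ^ v.length) := by
  cases v with
  | nil =>
    have h' := cons_mem_iff_lt_numChildren.1 h
    have h1 : (1 : ℝ) ≤ numChildren (familyTree z) [] := by exact_mod_cast (by omega)
    rw [stepProb_root_child lam h]
    simpa [visitBound] using inv_le_one_of_one_le₀ h1
  | cons a v =>
    have hpos : 0 < lam + numChildren (familyTree z) (a :: v) := by positivity
    rw [stepProb_child lam h, visitBound, if_neg (by simp), if_pos (cons_mem_familyTree.1 h).1,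
      ← ENNReal.ofReal_mul (by positivity)]
    apply ENNReal.ofReal_le_ofReal
    apply le_of_eq
    field_simp

theorem visitBound_mul_stepProb_parent_le {lam : ℝ} (hlam : 0 < lam) (z : Vertex → ℕ) (a : ℕ)
    (w : Vertex) :
    visitBound lam (familyTree z) (a :: w) * ENNReal.ofReal (stepProb lam (familyTree z) (a :: w) w)
      ≤ if a < numChildren (familyTree z) w then ENNReal.ofReal
        (1 / lam ^ w.length) else 0 := by
  rw [visitBound, if_neg (by simp)]
  by_cases h : a :: w ∈ familyTree z
  · have hpos : 0 < lam + numChildren (familyTree z) (a :: w) := by positivity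
    rw [if_pos h, if_pos (cons_mem_iff_lt_numChildren.1 h), stepProb_parent,
      ← ENNReal.ofReal_mul (by positivity)]
    apply ENNReal.ofReal_le_ofReal
    apply le_of_eq
    rw [List.length_cons, pow_succ]
    field_simp
  · rw [if_neg h, if_neg (fun h' => h (cons_mem_iff_lt_numChildren.2 h'))]
    simp

/-- Off the root, `visitBound` is superinvariant. -/
theorem tsum_visitBound_mul_stepProb_le {lam : ℝ} (hlam : 0 < lam) (z : Vertex → ℕ) {w : Vertex}
    (hw : w ≠ []) :
    ∑' u, visitBound lam (familyTree z) u * ENNReal.ofReal (stepProb lam (familyTree z) u w) ≤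
      visitBound lam (familyTree z) w := by
  obtain ⟨i, v, rfl⟩ := List.exists_cons_of_ne_nil hw
  set T := familyTree z with hT
  by_cases h : i :: v ∈ T
  · set q : Vertex → ℝ≥0∞ := fun u =>
      visitBound lam T u * ENNReal.ofReal (stepProb lam T u (i :: v)) with hq
    have hsplit : ∀ u, q u ≤ (if u = v then q v else 0) +
        ∑' a, if u = a :: i :: v then q (a :: i :: v) else 0 := by
      intro u
      by_cases hu : u = v
      · subst hu; simp
      · by_cases ha : ∃ a, u = a :: i :: v
        · obtain ⟨a, rfl⟩ := ha
          refine le_add_left ?_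
          refine le_trans ?_ (ENNReal.le_tsum a)
          simp
        · have : q u = 0 := by
            simp only [hq]
            rw [stepProb_cons_eq_zero lam (fun h' => absurd h' hu) (fun a h' => ha ⟨a, h'⟩)]
            simp
          simp [this]
    set c : ℝ := lam ^ v.length with hc
    have hcpos : 0 < c := by positivity
    calc ∑' u, q u ≤ ∑' u, ((if u = v then q v else 0) +
        ∑' a, if u = a :: i :: v then q (a :: i :: v) else 0) := ENNReal.tsum_le_tsum hsplit
      _ = q v + ∑' a, q (a :: i :: v) := by
        rw [ENNReal.tsum_add, ENNReal.tsum_comm]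
        simp
      _ ≤ ENNReal.ofReal (1 / c) + ∑' a, if a < numChildren T (i :: v) then
          ENNReal.ofReal (1 / lam ^ (v.length + 1)) else 0 :=
        add_le_add (visitBound_mul_stepProb_child_le hlam h)
          (ENNReal.tsum_le_tsum fun a => visitBound_mul_stepProb_parent_le hlam z a (i :: v))
      _ = visitBound lam T (i :: v) := by
        rw [tsum_eq_sum (s := Finset.range (numChildren T (i :: v)))
          (fun a ha => if_neg (by simpa using ha)),
          Finset.sum_congr rfl (fun a ha => if_pos (Finset.mem_range.1 ha)),
          Finset.sum_const, Finset.card_range, visitBound, if_neg (by simp), if_pos h,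
          nsmul_eq_mul, ← ENNReal.ofReal_natCast, ← ENNReal.ofReal_mul (by positivity),
          ← ENNReal.ofReal_add (by positivity) (by positivity), List.length_cons]
        congr 1
        rw [hc, pow_succ]
        field_simp
  · refine le_of_eq_of_le (ENNReal.tsum_eq_zero.2 fun u => ?_) zero_le
    by_cases ha : ∃ a, u = a :: i :: v
    · obtain ⟨a, rfl⟩ := ha
      rw [visitBound, if_neg (by simp), if_neg (fun h' => h (cons_mem_familyTree.1 h').1),
        zero_mul]
    · rw [stepProb_cons_eq_zero lam (fun _ => h) (fun a h' => ha ⟨a, h'⟩)]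
      simp

variable {Ω : Type*}

theorem measurable_visitBound [MeasurableSpace Ω] (lam : ℝ) {Z : Vertex → Ω → ℕ}
    (h : ∀ v, MeasurableSet {ω | v ∈ randomTree Z ω}) (v : Vertex) :
    Measurable fun ω => visitBound lam (randomTree Z ω) v := by
  have hr : ∀ v, Measurable fun ω => (numChildren (randomTree Z ω) v : ℝ) := fun v =>
    measurable_from_top.comp (measurable_numChildren h v)
  unfold visitBound
  refine Measurable.ite (MeasurableSet.const _) measurable_const
    (Measurable.ite (h v) ?_ measurable_const)
  exact (((hr v).const_add lam).div_const _).ennreal_ofReal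

variable [mΩ : MeasurableSpace Ω] {P : Measure Ω} [IsProbabilityMeasure P]
  {lam m : ℝ} {Z : Vertex → Ω → ℕ} {X : ℕ → Ω → Vertex}

/-- Given the tree, the expected number of visits to `v` before the return to the root is at most
`visitBound`, by induction on the number of steps. "Given the tree" is expressed by integrating
against an arbitrary nonnegative function `F` of the tree. -/
theorem sum_lintegral_visits_le (hlam : 0 < lam)
    (h : ∀ v, MeasurableSet {ω | v ∈ randomTree Z ω})
    (hX : IsBiasedWalk P lam (randomTree Z) X) (n : ℕ) (w : Vertex) {F : Ω → ℝ≥0∞}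
    (hF : Measurable[treeInfo (randomTree Z)] F) :
    ∑ k ∈ Finset.range n, ∫⁻ ω, (awayUpTo X k ∩ {ω | X k ω = w}).indicator F ω ∂P ≤
      ∫⁻ ω, F ω * visitBound lam (randomTree Z ω) w ∂P := by
  have hT := treeInfo_le h
  have hset : ∀ k u, MeasurableSet[history (randomTree Z) X k]
      (awayUpTo X k ∩ {ω | X k ω = u}) := fun k u =>
    (measurableSet_awayUpTo (randomTree Z) X k).inter (measurableSet_history le_rfl {u})
  induction n generalizing w F with
  | zero => simp
  | succ n ih =>
    rw [Finset.sum_range_succ']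
    by_cases hw : w = []
    · subst hw
      rw [Finset.sum_eq_zero, zero_add]
      · refine lintegral_mono fun ω => ?_
        simp only [visitBound, if_true, mul_one]
        exact Set.indicator_le_self _ _ ω
      · intro k _
        rw [show awayUpTo X (k + 1) ∩ {ω | X (k + 1) ω = []} = ∅ from ?_]
        · simp
        · ext ω
          simp only [Set.mem_inter_iff, mem_awayUpTo_succ, Set.mem_ofPred_eq,
            Set.mem_empty_iff_false]
          tauto
    · have h0 : ∫⁻ ω, (awayUpTo X 0 ∩ {ω | X 0 ω = w}).indicator F ω ∂P = 0 := by
        rw [lintegral_congr_ae (g := fun _ => 0)]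
        · simp
        · filter_upwards [hX.start] with ω hω
          refine Set.indicator_of_notMem (fun h' => hw ?_) _
          exact h'.2.symm.trans hω
      have hp : ∀ u, Measurable[treeInfo (randomTree Z)] fun ω =>
          F ω * ENNReal.ofReal (stepProb lam (randomTree Z ω) u w) := fun u =>
        hF.mul (@measurable_stepProb Ω (treeInfo (randomTree Z)) Z lam
          (measurableSet_treeInfo _) u w).ennreal_ofReal
      have hstep : ∀ k, ∫⁻ ω, (awayUpTo X (k + 1) ∩ {ω | X (k + 1) ω = w}).indicator F ω ∂P =
          ∑' u, ∫⁻ ω, (awayUpTo X k ∩ {ω | X k ω = u}).indicator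
            (fun ω => F ω * ENNReal.ofReal (stepProb lam (randomTree Z ω) u w)) ω ∂P := by
        intro k
        have e1 : (awayUpTo X (k + 1) ∩ {ω | X (k + 1) ω = w}).indicator F =
            {ω | X (k + 1) ω = w}.indicator ((awayUpTo X k).indicator F) := by
          rw [Set.indicator_indicator]
          congr 1
          ext ω
          simp only [Set.mem_inter_iff, mem_awayUpTo_succ, Set.mem_ofPred_eq]
          constructor
          · tauto
          · rintro ⟨rfl, h2⟩
            exact ⟨⟨h2, hw⟩, rfl⟩
        rw [e1, lintegral_indicator_step hlam.le h hX k w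
          ((hF.mono (treeInfo_le_history _ X k) le_rfl).indicator
            (measurableSet_awayUpTo (randomTree Z) X k)), ← lintegral_tsum]
        · refine lintegral_congr fun ω => ?_
          rw [tsum_eq_single (X k ω)]
          · by_cases hω : ω ∈ awayUpTo X k
            · rw [Set.indicator_of_mem hω,
                Set.indicator_of_mem (s := awayUpTo X k ∩ {ω' | X k ω' = X k ω}) ⟨hω, rfl⟩,
                mul_comm]
            · rw [Set.indicator_of_notMem hω, Set.indicator_of_notMem (fun h' => hω h'.1),
                mul_zero]
          · intro u hu
            exact Set.indicator_of_notMem (s := awayUpTo X k ∩ {ω | X k ω = u})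
              (fun h' => hu h'.2.symm) _
        · exact fun u => (((hp u).mono hT le_rfl).indicator
            (history_le h hX k _ (hset k u))).aemeasurable
      rw [h0, add_zero, Finset.sum_congr rfl fun k _ => hstep k,
        ← Summable.tsum_finsetSum fun _ _ => ENNReal.summable]
      calc _ ≤ ∑' u, ∫⁻ ω, F ω * ENNReal.ofReal (stepProb lam (randomTree Z ω) u w) *
            visitBound lam (randomTree Z ω) u ∂P := ENNReal.tsum_le_tsum fun u => ih u (hp u)
        _ = ∫⁻ ω, F ω * ∑' u, visitBound lam (randomTree Z ω) u *
            ENNReal.ofReal (stepProb lam (randomTree Z ω) u w) ∂P := by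
          have hm : ∀ u, AEMeasurable (fun ω => F ω * ENNReal.ofReal
              (stepProb lam (randomTree Z ω) u w) * visitBound lam (randomTree Z ω) u) P :=
            fun u => (((hp u).mono hT le_rfl).mul (measurable_visitBound lam h u)).aemeasurable
          rw [← lintegral_tsum hm]
          refine lintegral_congr fun ω => ?_
          rw [← ENNReal.tsum_mul_left]
          exact tsum_congr fun u => by rw [mul_assoc, mul_comm (ENNReal.ofReal _)]
        _ ≤ _ := lintegral_mono fun ω => by
          gcongr
          exact tsum_visitBound_mul_stepProb_le hlam _ hw

theorem tsum_measure_awayUpTo_le (hlam : 0 < lam)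
    (h : ∀ v, MeasurableSet {ω | v ∈ randomTree Z ω})
    (hX : IsBiasedWalk P lam (randomTree Z) X) :
    ∑' k, P (awayUpTo X k) ≤ ∑' v, ∫⁻ ω, visitBound lam (randomTree Z ω) v ∂P := by
  have hset : ∀ k u, MeasurableSet (awayUpTo X k ∩ {ω | X k ω = u}) := fun k u =>
    history_le h hX k _
      ((measurableSet_awayUpTo (randomTree Z) X k).inter (measurableSet_history le_rfl {u}))
  have hk : ∀ k, P (awayUpTo X k) = ∑' v, P (awayUpTo X k ∩ {ω | X k ω = v}) := by
    intro k
    rw [← measure_iUnion _ (hset k)]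
    · congr 1
      ext ω
      simp
    · intro u v huv
      refine Set.disjoint_left.2 fun ω hu hv => huv ?_
      exact hu.2.symm.trans hv.2
  rw [ENNReal.tsum_eq_iSup_nat]
  refine iSup_le fun n => ?_
  rw [Finset.sum_congr rfl fun k _ => hk k, ← Summable.tsum_finsetSum fun _ _ => ENNReal.summable]
  refine ENNReal.tsum_le_tsum fun v => ?_
  have := sum_lintegral_visits_le hlam h hX n v (F := fun _ => 1) measurable_const
  simpa only [lintegral_indicator_const (hset _ _), one_mul] using this

/-- The expected size of the `n`-th generation. -/
theorem levelSum_measure_mem (hZ : IsOffspringFamily P Z m) (n : ℕ) :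
    levelSum (fun v => P {ω | v ∈ randomTree Z ω}) n = ENNReal.ofReal m ^ n := by
  induction n with
  | zero =>
    rw [levelSum_zero, pow_zero]
    exact (congrArg P (Set.eq_univ_of_forall fun ω => trivial)).trans measure_univ
  | succ n ih =>
    rw [levelSum_succ]
    simp_rw [measure_cons_mem hZ, ENNReal.tsum_mul_left, tsum_measure_lt_offspring hZ]
    rw [levelSum_mul_right, ih, pow_succ]

theorem lintegral_visitBound_le (hlam : 0 < lam) (hZ : IsOffspringFamily P Z m) (v : Vertex) :
    ∫⁻ ω, visitBound lam (randomTree Z ω) v ∂P ≤ P {ω | v ∈ randomTree Z ω} *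
      ((1 + ENNReal.ofReal lam + ENNReal.ofReal m) * ENNReal.ofReal (1 / lam ^ v.length)) := by
  have hd : Disjoint {u : Vertex | u.length < v.length} {v} := by
    rw [Set.disjoint_singleton_right]; simp
  have h1 := measurableSet_mem_randomTree hZ.measurable v
  have hmeas : Measurable[offspringInfo Z {v}] fun ω =>
      (1 + ENNReal.ofReal lam + (Z v ω : ℝ≥0∞)) * ENNReal.ofReal (1 / lam ^ v.length) :=
    (((measurable_from_top (f := fun k : ℕ => (k : ℝ≥0∞))).comp
      (measurable_offspringInfo Z (S := {v}) rfl)).const_add _).mul_const _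
  have key := lintegral_mul_of_disjoint hZ hd
    (measurable_indicator_one (measurableSet_mem_offspringInfo Z v)) hmeas
  have hZm : Measurable fun ω => (Z v ω : ℝ≥0∞) :=
    (measurable_from_top (f := fun k : ℕ => (k : ℝ≥0∞))).comp (hZ.measurable v)
  rw [lintegral_indicator_one h1, lintegral_mul_const _ (hZm.const_add _),
    lintegral_add_left measurable_const, lintegral_offspring hZ, lintegral_const, measure_univ,
    mul_one] at key
  rw [← key]
  refine lintegral_mono fun ω => ?_
  by_cases hω : v ∈ randomTree Z ω
  · rw [Set.indicator_of_mem (s := {ω | v ∈ randomTree Z ω}) hω, Pi.one_apply, one_mul,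
      visitBound]
    split_ifs with hv
    · subst hv
      simp only [List.length_nil, pow_zero, div_one, ENNReal.ofReal_one, mul_one, add_assoc]
      exact le_self_add
    · rw [randomTree, numChildren_of_mem hω, div_eq_mul_one_div,
        ENNReal.ofReal_mul (by positivity), ENNReal.ofReal_add hlam.le (by positivity),
        ENNReal.ofReal_natCast]
      gcongr
      exact le_add_self
  · rw [visitBound, if_neg, if_neg hω]
    · exact zero_le
    · rintro rfl
      exact hω trivial

theorem isPositiveRecurrent_of_mean_lt (hlam : 0 < lam) (hm : 0 ≤ m) (hml : m < lam)
    (hZ : IsOffspringFamily P Z m) (hX : IsBiasedWalk P lam (randomTree Z) X) :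
    IsPositiveRecurrent P X := by
  have h := measurableSet_mem_randomTree hZ.measurable
  have hA : ∀ k, MeasurableSet (awayUpTo X k) := fun k =>
    history_le h hX k _ (measurableSet_awayUpTo (randomTree Z) X k)
  have hsum : ∑' k, P (awayUpTo X k) < ∞ := by
    set c := 1 + ENNReal.ofReal lam + ENNReal.ofReal m with hc
    have hlev : ∀ n, levelSum (fun v => P {ω | v ∈ randomTree Z ω} *
        (c * ENNReal.ofReal (1 / lam ^ v.length))) n = ENNReal.ofReal (m / lam) ^ n * c := by
      intro n
      have : levelSum (fun v => P {ω | v ∈ randomTree Z ω} *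
          (c * ENNReal.ofReal (1 / lam ^ v.length))) n =
          levelSum (fun v => P {ω | v ∈ randomTree Z ω} *
          (c * ENNReal.ofReal (1 / lam ^ n))) n :=
        le_antisymm (levelSum_mono fun v hv => by rw [hv]) (levelSum_mono fun v hv => by rw [hv])
      rw [this, levelSum_mul_right, levelSum_measure_mem hZ, ← ENNReal.ofReal_pow hm,
        ← ENNReal.ofReal_pow (by positivity), mul_comm c, ← mul_assoc,
        ← ENNReal.ofReal_mul (by positivity), div_pow, mul_one_div]
    calc ∑' k, P (awayUpTo X k) ≤ ∑' v, ∫⁻ ω, visitBound lam (randomTree Z ω) v ∂P :=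
          tsum_measure_awayUpTo_le hlam h hX
      _ ≤ ∑' v, P {ω | v ∈ randomTree Z ω} * (c * ENNReal.ofReal (1 / lam ^ v.length)) :=
          ENNReal.tsum_le_tsum (lintegral_visitBound_le hlam hZ)
      _ = (∑' n, ENNReal.ofReal (m / lam) ^ n) * c := by
          rw [← tsum_levelSum, tsum_congr hlev, ENNReal.tsum_mul_right]
      _ < ∞ := by
          refine ENNReal.mul_lt_top ?_ (by simp [hc])
          rw [ENNReal.tsum_geometric, ENNReal.inv_lt_top, tsub_pos_iff_lt, ENNReal.ofReal_lt_one]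
          exact (div_lt_one hlam).2 hml
  have hint : ∫⁻ ω, ∑' k, (awayUpTo X k).indicator 1 ω ∂P = ∑' k, P (awayUpTo X k) := by
    rw [lintegral_tsum fun k => (measurable_indicator_one (hA k)).aemeasurable]
    exact tsum_congr fun k => lintegral_indicator_one (hA k)
  refine ⟨?_, (lintegral_mono (returnTime_le_tsum X)).trans_lt (hint ▸ hsum)⟩
  rw [IsTransient, not_lt, nonpos_iff_eq_zero]
  have hfin := ae_lt_top (Measurable.tsum fun k => measurable_indicator_one (hA k))
    (hint ▸ hsum.ne)
  refine measure_mono_null (fun ω hω => ?_) hfin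
  have hle := returnTime_le_tsum X ω
  rw [Set.mem_ofPred_eq] at hω
  rw [hω] at hle
  simpa using hle

end Recurrence

/-! ### A subharmonic function built from a finite-energy flow -/

section Flow

/-- The number of descendants `j` generations below `v`, when only the first `N` children of every
vertex are kept. -/
noncomputable def truncPop (N : ℕ) (y : Vertex → ℕ) : ℕ → Vertex → ℝ≥0
  | 0, _ => 1
  | j + 1, v => ∑ i ∈ Finset.range N, if i < y v then truncPop N y j (i :: v) else 0

/-- The energy of the flow which sends one unit from `v` to each of the descendants counted by
`truncPop N y j v`, when an edge `k` generations below the edge leading to `v` has resistance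
`lam ^ k`. The edge leading to `v` itself is included. -/
noncomputable def flowEnergy (lam : ℝ≥0) (N : ℕ) (y : Vertex → ℕ) : ℕ → Vertex → ℝ≥0
  | 0, _ => 1
  | j + 1, v => truncPop N y (j + 1) v ^ 2 +
      lam * ∑ i ∈ Finset.range N, if i < y v then flowEnergy lam N y j (i :: v) else 0

/-- Thomson's lower bound, by the energy of the flow `truncPop`, for the probability that the walk
started at `v` gets `j` generations below `v` before it visits the parent of `v`. -/
noncomputable def escapeBound (lam : ℝ≥0) (N : ℕ) (y : Vertex → ℕ) (j : ℕ) (v : Vertex) : ℝ≥0 :=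
  truncPop N y j v ^ 2 / flowEnergy lam N y j v

variable (lam : ℝ≥0) (N : ℕ) (y : Vertex → ℕ)

theorem truncPop_sq_le_flowEnergy (j : ℕ) (v : Vertex) :
    truncPop N y j v ^ 2 ≤ flowEnergy lam N y j v := by
  cases j with
  | zero => simp [truncPop, flowEnergy]
  | succ j => rw [flowEnergy]; exact le_self_add

theorem escapeBound_le_one (j : ℕ) (v : Vertex) : escapeBound lam N y j v ≤ 1 :=
  div_le_one_of_le₀ (truncPop_sq_le_flowEnergy lam N y j v) zero_le

theorem truncPop_sq_eq (j : ℕ) (v : Vertex) :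
    truncPop N y j v ^ 2 = escapeBound lam N y j v * flowEnergy lam N y j v := by
  unfold escapeBound
  by_cases h : flowEnergy lam N y j v = 0
  · have := truncPop_sq_le_flowEnergy lam N y j v
    rw [h, nonpos_iff_eq_zero] at this
    rw [this, h, mul_zero]
  · rw [div_mul_cancel₀ _ h]

/-- The Cauchy–Schwarz inequality turns the recursion of the energy into the series and parallel
laws for escape probabilities, with an inequality. Children beyond the truncation only help. -/
theorem escapeBound_succ_mul_le (j : ℕ) (v : Vertex) :
    escapeBound lam N y (j + 1) v *
        (lam + ∑ i ∈ Finset.range (y v), escapeBound lam N y j (i :: v)) ≤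
      ∑ i ∈ Finset.range (y v), escapeBound lam N y j (i :: v) := by
  set S := ∑ i ∈ Finset.range (y v), escapeBound lam N y j (i :: v) with hS
  set e := ∑ i ∈ Finset.range N, if i < y v then flowEnergy lam N y j (i :: v) else 0 with he
  set t := truncPop N y (j + 1) v with ht
  have hE : flowEnergy lam N y (j + 1) v = t ^ 2 + lam * e := rfl
  have hCS : t ^ 2 ≤ S * e := by
    rw [ht, truncPop, he, ← Finset.sum_filter, ← Finset.sum_filter]
    refine (Finset.sum_sq_le_sum_mul_sum_of_sq_le_mul _
      (f := fun i => escapeBound lam N y j (i :: v)) (fun _ _ => zero_le) (fun _ _ => zero_le)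
      fun i _ => (truncPop_sq_eq lam N y j (i :: v)).le).trans ?_
    gcongr
    refine Finset.sum_le_sum_of_subset fun i hi => ?_
    simpa using (Finset.mem_filter.1 hi).2
  rw [escapeBound, hE, ← ht]
  by_cases h0 : t ^ 2 + lam * e = 0
  · rw [h0, div_zero, zero_mul]
    exact zero_le
  · rw [div_mul_eq_mul_div, div_le_iff₀ (pos_iff_ne_zero.2 h0)]
    calc t ^ 2 * (lam + S) = t ^ 2 * lam + t ^ 2 * S := mul_add _ _ _
      _ ≤ S * e * lam + t ^ 2 * S := by gcongr
      _ = S * (t ^ 2 + lam * e) := by ring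

/-- A lower bound for the probability of reaching level `n` before the root. It is obtained from
the bounds `escapeBound` by descending one edge at a time. -/
noncomputable def climbBound (n : ℕ) : Vertex → ℝ≥0
  | [] => 0
  | i :: v => escapeBound lam N y (n - (v.length + 1)) (i :: v) +
      (1 - escapeBound lam N y (n - (v.length + 1)) (i :: v)) * climbBound n v

theorem coe_climbBound_cons (n i : ℕ) (v : Vertex) :
    (climbBound lam N y n (i :: v) : ℝ) = escapeBound lam N y (n - (v.length + 1)) (i :: v) +
      (1 - escapeBound lam N y (n - (v.length + 1)) (i :: v)) * climbBound lam N y n v := by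
  rw [climbBound, NNReal.coe_add, NNReal.coe_mul,
    NNReal.coe_sub (escapeBound_le_one lam N y _ _), NNReal.coe_one]

theorem climbBound_le_one (n : ℕ) (v : Vertex) : climbBound lam N y n v ≤ 1 := by
  induction v with
  | nil => simp [climbBound]
  | cons i v ih =>
    rw [climbBound]
    calc _ ≤ escapeBound lam N y (n - (v.length + 1)) (i :: v) +
        (1 - escapeBound lam N y (n - (v.length + 1)) (i :: v)) * 1 := by gcongr
      _ = 1 := by rw [mul_one, add_tsub_cancel_of_le (escapeBound_le_one lam N y _ _)]

/-- `climbBound` is subharmonic for the biased walk at the vertices other than the root which are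
closer to the root than level `n`. -/
theorem climbBound_subharmonic (n a : ℕ) (u : Vertex) (h : (a :: u).length < n) :
    (lam + y (a :: u)) * climbBound lam N y n (a :: u) ≤ lam * climbBound lam N y n u +
      ∑ i ∈ Finset.range (y (a :: u)), climbBound lam N y n (i :: a :: u) := by
  rw [List.length_cons] at h
  obtain ⟨j, hj⟩ : ∃ j, n = j + 1 + (u.length + 1) := ⟨n - (u.length + 2), by omega⟩
  have e1 : n - (u.length + 1) = j + 1 := by omega
  have e2 : n - ((a :: u).length + 1) = j := by rw [List.length_cons]; omega
  have key := escapeBound_succ_mul_le lam N y j (a :: u)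
  have hG := climbBound_le_one lam N y n u
  rw [← NNReal.coe_le_coe] at key hG ⊢
  push_cast at key hG ⊢
  simp_rw [coe_climbBound_cons lam N y n _ (a :: u), e2]
  set g : ℝ := (climbBound lam N y n (a :: u) : ℝ) with hg
  have hsum : ∑ i ∈ Finset.range (y (a :: u)), ((escapeBound lam N y j (i :: a :: u) : ℝ) +
      (1 - escapeBound lam N y j (i :: a :: u)) * g) =
      (∑ i ∈ Finset.range (y (a :: u)), (escapeBound lam N y j (i :: a :: u) : ℝ)) * (1 - g) +
        y (a :: u) * g := by
    rw [Finset.sum_congr rfl (g := fun i => (escapeBound lam N y j (i :: a :: u) : ℝ) * (1 - g) + g)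
      fun i _ => by ring, Finset.sum_add_distrib, ← Finset.sum_mul, Finset.sum_const,
      Finset.card_range, nsmul_eq_mul]
  rw [hsum]
  have hgv : g = escapeBound lam N y (j + 1) (a :: u) +
      (1 - escapeBound lam N y (j + 1) (a :: u)) * climbBound lam N y n u := by
    rw [hg, coe_climbBound_cons, e1]
  set S : ℝ := ∑ i ∈ Finset.range (y (a :: u)), (escapeBound lam N y j (i :: a :: u) : ℝ)
  set b : ℝ := (escapeBound lam N y (j + 1) (a :: u) : ℝ)
  set G : ℝ := (climbBound lam N y n u : ℝ)
  have := mul_nonneg (sub_nonneg.2 key) (sub_nonneg.2 hG)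
  rw [hgv]
  nlinarith

variable {N y}

/-- The flow and its energy at a vertex of the tree depend on the tree alone. -/
theorem truncPop_numChildren (z : Vertex → ℕ) (j : ℕ) {v : Vertex} (hv : v ∈ familyTree z) :
    truncPop N (numChildren (familyTree z)) j v = truncPop N z j v := by
  induction j generalizing v with
  | zero => rfl
  | succ j ih =>
    rw [truncPop, truncPop, numChildren_of_mem hv]
    exact Finset.sum_congr rfl fun i _ => if_ctx_congr Iff.rfl
      (fun hi => ih (cons_mem_familyTree.2 ⟨hv, hi⟩)) fun _ => rfl

theorem flowEnergy_numChildren (z : Vertex → ℕ) (j : ℕ) {v : Vertex} (hv : v ∈ familyTree z) :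
    flowEnergy lam N (numChildren (familyTree z)) j v = flowEnergy lam N z j v := by
  induction j generalizing v with
  | zero => rfl
  | succ j ih =>
    rw [flowEnergy, flowEnergy, numChildren_of_mem hv, truncPop_numChildren z _ hv]
    congr 2
    exact Finset.sum_congr rfl fun i _ => if_ctx_congr Iff.rfl
      (fun hi => ih (cons_mem_familyTree.2 ⟨hv, hi⟩)) fun _ => rfl

variable {Ω : Type*} {mΩ : MeasurableSpace Ω} {Y : Vertex → Ω → ℕ}

theorem measurable_truncPop (N j : ℕ) {v : Vertex} (hY : ∀ u, v <:+ u → Measurable (Y u)) :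
    Measurable fun ω => truncPop N (fun u => Y u ω) j v := by
  induction j generalizing v with
  | zero => exact measurable_const
  | succ j ih =>
    simp only [truncPop]
    refine Finset.measurable_fun_sum _ fun i _ => ?_
    exact Measurable.ite (measurableSet_lt measurable_const (hY v List.suffix_rfl))
      (ih fun u hu => hY u ((List.suffix_cons i v).trans hu)) measurable_const

theorem measurable_flowEnergy (N j : ℕ) {v : Vertex} (hY : ∀ u, v <:+ u → Measurable (Y u)) :
    Measurable fun ω => flowEnergy lam N (fun u => Y u ω) j v := by
  induction j generalizing v with
  | zero => exact measurable_const
  | succ j ih =>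
    simp only [flowEnergy]
    refine ((measurable_truncPop N (j + 1) hY).pow_const 2).add (Measurable.const_mul ?_ _)
    refine Finset.measurable_fun_sum _ fun i _ => ?_
    exact Measurable.ite (measurableSet_lt measurable_const (hY v List.suffix_rfl))
      (ih fun u hu => hY u ((List.suffix_cons i v).trans hu)) measurable_const

theorem measurable_escapeBound (N j : ℕ) {v : Vertex} (hY : ∀ u, v <:+ u → Measurable (Y u)) :
    Measurable fun ω => escapeBound lam N (fun u => Y u ω) j v :=
  ((measurable_truncPop N j hY).pow_const 2).div (measurable_flowEnergy lam N j hY)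

theorem measurable_climbBound (N n : ℕ) (hY : ∀ u, Measurable (Y u)) (v : Vertex) :
    Measurable fun ω => climbBound lam N (fun u => Y u ω) n v := by
  induction v with
  | nil => exact measurable_const
  | cons i v ih =>
    have := measurable_escapeBound lam N (n - (v.length + 1)) (v := i :: v) fun u _ => hY u
    exact this.add ((measurable_const.sub this).mul ih)

end Flow

/-! ### Moments of the flow -/

section Moments

variable {Ω : Type*}

/-- The potential vertices of the subtree rooted at `v`. -/
abbrev descendants (v : Vertex) : Set Vertex := {u | v <:+ u}

theorem measurable_truncPop_offspringInfo (Z : Vertex → Ω → ℕ) (N j : ℕ) (v : Vertex) :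
    Measurable[offspringInfo Z (descendants v)]
      fun ω => (truncPop N (fun u => Z u ω) j v : ℝ≥0∞) :=
  (measurable_truncPop (mΩ := offspringInfo Z (descendants v)) N j fun _ hu =>
    measurable_offspringInfo Z hu).coe_nnreal_ennreal

theorem measurable_flowEnergy_offspringInfo (Z : Vertex → Ω → ℕ) (lam : ℝ≥0) (N j : ℕ)
    (v : Vertex) : Measurable[offspringInfo Z (descendants v)]
      fun ω => (flowEnergy lam N (fun u => Z u ω) j v : ℝ≥0∞) :=
  (measurable_flowEnergy (mΩ := offspringInfo Z (descendants v)) lam N j fun _ hu =>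
    measurable_offspringInfo Z hu).coe_nnreal_ennreal

variable [mΩ : MeasurableSpace Ω] {P : Measure Ω} {Z : Vertex → Ω → ℕ} {m : ℝ}

theorem disjoint_singleton_descendants (i : ℕ) (v : Vertex) :
    Disjoint {v} (descendants (i :: v)) := by
  rw [Set.disjoint_singleton_left]
  intro h
  have := List.IsSuffix.length_le h
  simp at this

theorem disjoint_descendants {i k : ℕ} (hik : i ≠ k) (v : Vertex) :
    Disjoint (descendants (i :: v)) (descendants (k :: v)) := by
  refine Set.disjoint_left.2 fun u hi hk => hik ?_
  have := (List.suffix_of_suffix_length_le hi hk (by simp)).eq_of_length (by simp)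
  exact (List.cons.inj this).1

theorem lintegral_ite_lt_offspring (hZ : IsOffspringFamily P Z m) (i : ℕ) (v : Vertex)
    {f : Ω → ℝ≥0∞} (hf : Measurable[offspringInfo Z (descendants (i :: v))] f) :
    ∫⁻ ω, (if i < Z v ω then f ω else 0) ∂P = P {ω | i < Z [] ω} * ∫⁻ ω, f ω ∂P := by
  have := lintegral_mul_of_disjoint hZ (disjoint_singleton_descendants i v)
    (measurable_indicator_one
      (measurable_offspringInfo Z (S := {v}) rfl (measurableSet_Ioi (a := i)))) hf
  have e : Z v ⁻¹' Set.Ioi i = {ω | i < Z v ω} := rfl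
  rw [e, lintegral_indicator_one (measurableSet_lt_offspring hZ v i),
    measure_lt_offspring hZ] at this
  rw [← this]
  refine lintegral_congr fun ω => ?_
  by_cases h : i < Z v ω <;> simp [h]

/-- The mean of the offspring distribution truncated at `N`. -/
noncomputable def truncMean (P : Measure Ω) (Z : Vertex → Ω → ℕ) (N : ℕ) : ℝ≥0∞ :=
  ∑ i ∈ Finset.range N, P {ω | i < Z [] ω}

theorem coe_ite_zero (p : Prop) [Decidable p] (x : ℝ≥0) :
    ((if p then x else 0 : ℝ≥0) : ℝ≥0∞) = if p then (x : ℝ≥0∞) else 0 := by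
  split_ifs <;> rfl

variable [IsProbabilityMeasure P]

theorem lintegral_truncPop (hZ : IsOffspringFamily P Z m) (N j : ℕ) (v : Vertex) :
    ∫⁻ ω, (truncPop N (fun u => Z u ω) j v : ℝ≥0∞) ∂P = truncMean P Z N ^ j := by
  induction j generalizing v with
  | zero => simp [truncPop]
  | succ j ih =>
    simp only [truncPop, ENNReal.ofNNReal_finsetSum, coe_ite_zero]
    rw [lintegral_finsetSum]
    · rw [Finset.sum_congr rfl fun i _ => lintegral_ite_lt_offspring hZ i v
        (measurable_truncPop_offspringInfo Z N j (i :: v))]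
      simp_rw [ih]
      rw [← Finset.sum_mul, pow_succ', truncMean]
    · exact fun i _ => Measurable.ite (measurableSet_lt_offspring hZ v i)
        ((measurable_truncPop_offspringInfo Z N j (i :: v)).mono
          (offspringInfo_le hZ.measurable _) le_rfl) measurable_const

/-- The normalized population is bounded in `L²`: the diagonal terms of the square give a factor
`truncMean`, and there are at most `N ^ 2` off-diagonal terms, which factorize. -/
theorem lintegral_truncPop_sq_le (hZ : IsOffspringFamily P Z m) (N : ℕ) {C : ℝ≥0∞} (hC : 1 ≤ C)
    (hCM : C * truncMean P Z N + N ^ 2 ≤ C * truncMean P Z N ^ 2) (j : ℕ) (v : Vertex) :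
    ∫⁻ ω, (truncPop N (fun u => Z u ω) j v : ℝ≥0∞) ^ 2 ∂P ≤ C * truncMean P Z N ^ (2 * j) := by
  induction j generalizing v with
  | zero => simpa [truncPop] using hC
  | succ j ih =>
    set M := truncMean P Z N with hM
    set θ : ℕ → Ω → ℝ≥0∞ := fun i ω => truncPop N (fun u => Z u ω) j (i :: v) with hθ
    have hθm : ∀ i, Measurable (θ i) := fun i =>
      (measurable_truncPop_offspringInfo Z N j (i :: v)).mono
        (offspringInfo_le hZ.measurable _) le_rfl
    have hpt : ∀ ω, (truncPop N (fun u => Z u ω) (j + 1) v : ℝ≥0∞) ^ 2 ≤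
        ∑ i ∈ Finset.range N, ((if i < Z v ω then θ i ω ^ 2 else 0) +
          ∑ k ∈ Finset.range N, if k = i then 0 else θ i ω * θ k ω) := by
      intro ω
      simp only [truncPop, ENNReal.ofNNReal_finsetSum, coe_ite_zero]
      rw [sq, Finset.sum_mul_sum]
      refine Finset.sum_le_sum fun i hi => ?_
      rw [← Finset.add_sum_erase _ _ hi]
      refine add_le_add ?_ ((Finset.sum_le_sum (g := fun k => if k = i then 0 else θ i ω * θ k ω)
        fun k hk => ?_).trans
        (Finset.sum_le_sum_of_subset (Finset.erase_subset _ _)))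
      · split_ifs
        · exact (sq _).ge
        · simp
      · rw [if_neg (Finset.ne_of_mem_erase hk)]
        refine mul_le_mul' ?_ ?_ <;> split_ifs <;> first | exact le_rfl | exact zero_le
    have hoff : ∀ i k, ∫⁻ ω, (if k = i then 0 else θ i ω * θ k ω) ∂P ≤ M ^ (2 * j) := by
      intro i k
      by_cases hik : k = i
      · simp [hik]
      · simp only [if_neg hik]
        rw [lintegral_mul_of_disjoint hZ (disjoint_descendants (Ne.symm hik) v)
          (measurable_truncPop_offspringInfo Z N j (i :: v))
          (measurable_truncPop_offspringInfo Z N j (k :: v)), lintegral_truncPop hZ,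
          lintegral_truncPop hZ, ← pow_add, two_mul]
    have hoffm : ∀ i k, Measurable fun ω => if k = i then 0 else θ i ω * θ k ω := fun i k =>
      Measurable.ite (MeasurableSet.const _) measurable_const ((hθm i).mul (hθm k))
    have hdiagm : ∀ i, Measurable fun ω => if i < Z v ω then θ i ω ^ 2 else 0 := fun i =>
      Measurable.ite (measurableSet_lt_offspring hZ v i) ((hθm i).pow_const 2) measurable_const
    calc ∫⁻ ω, (truncPop N (fun u => Z u ω) (j + 1) v : ℝ≥0∞) ^ 2 ∂P
        ≤ ∫⁻ ω, ∑ i ∈ Finset.range N, ((if i < Z v ω then θ i ω ^ 2 else 0) +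
          ∑ k ∈ Finset.range N, if k = i then 0 else θ i ω * θ k ω) ∂P := lintegral_mono hpt
      _ = ∑ i ∈ Finset.range N, (P {ω | i < Z [] ω} * ∫⁻ ω, θ i ω ^ 2 ∂P +
          ∑ k ∈ Finset.range N, ∫⁻ ω, (if k = i then 0 else θ i ω * θ k ω) ∂P) := by
        have hm : ∀ i, Measurable fun ω => (if i < Z v ω then θ i ω ^ 2 else 0) +
            ∑ k ∈ Finset.range N, if k = i then 0 else θ i ω * θ k ω := fun i =>
          (hdiagm i).add (Finset.measurable_fun_sum _ fun k _ => hoffm i k)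
        rw [lintegral_finsetSum _ fun i _ => hm i]
        refine Finset.sum_congr rfl fun i _ => ?_
        rw [lintegral_add_left (hdiagm i), lintegral_finsetSum _ fun k _ => hoffm i k,
          lintegral_ite_lt_offspring hZ i v
            ((measurable_truncPop_offspringInfo Z N j (i :: v)).pow_const 2)]
      _ ≤ ∑ i ∈ Finset.range N, (P {ω | i < Z [] ω} * (C * M ^ (2 * j)) +
          ∑ k ∈ Finset.range N, M ^ (2 * j)) := by
        gcongr with i _ k _
        · exact ih (i :: v)
        · exact hoff i k
      _ = (C * M + N ^ 2) * M ^ (2 * j) := by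
        rw [Finset.sum_add_distrib, ← Finset.sum_mul, ← truncMean, ← hM]
        simp only [Finset.sum_const, Finset.card_range, nsmul_eq_mul]
        ring
      _ ≤ C * M ^ 2 * M ^ (2 * j) := by gcongr
      _ = C * M ^ (2 * (j + 1)) := by ring

theorem lintegral_flowEnergy_le (hZ : IsOffspringFamily P Z m) (lam : ℝ≥0) (N : ℕ) {C K : ℝ≥0∞}
    (hC : 1 ≤ C) (hCM : C * truncMean P Z N + N ^ 2 ≤ C * truncMean P Z N ^ 2) (hK : 1 ≤ K)
    (hKM : C * truncMean P Z N ^ 2 + lam * (truncMean P Z N * K) ≤ K * truncMean P Z N ^ 2)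
    (j : ℕ) (v : Vertex) :
    ∫⁻ ω, (flowEnergy lam N (fun u => Z u ω) j v : ℝ≥0∞) ∂P ≤ K * truncMean P Z N ^ (2 * j) := by
  induction j generalizing v with
  | zero => simpa [flowEnergy] using hK
  | succ j ih =>
    set M := truncMean P Z N with hM
    have hm : ∀ i, Measurable fun ω =>
        if i < Z v ω then (flowEnergy lam N (fun u => Z u ω) j (i :: v) : ℝ≥0∞) else 0 :=
      fun i => Measurable.ite (measurableSet_lt_offspring hZ v i)
        ((measurable_flowEnergy_offspringInfo Z lam N j (i :: v)).mono
          (offspringInfo_le hZ.measurable _) le_rfl) measurable_const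
    simp only [flowEnergy, ENNReal.coe_add, ENNReal.coe_pow, ENNReal.coe_mul,
      ENNReal.ofNNReal_finsetSum, coe_ite_zero]
    rw [lintegral_add_right _ ((Finset.measurable_fun_sum _ fun i _ => hm i).const_mul _),
      lintegral_const_mul _ (Finset.measurable_fun_sum _ fun i _ => hm i),
      lintegral_finsetSum _ fun i _ => hm i,
      Finset.sum_congr rfl fun i _ => lintegral_ite_lt_offspring hZ i v
        (measurable_flowEnergy_offspringInfo Z lam N j (i :: v))]
    calc _ ≤ C * M ^ (2 * (j + 1)) +
          lam * ∑ i ∈ Finset.range N, P {ω | i < Z [] ω} * (K * M ^ (2 * j)) := by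
          gcongr with i _
          · exact lintegral_truncPop_sq_le hZ N hC hCM (j + 1) v
          · exact ih (i :: v)
      _ = (C * M ^ 2 + lam * (M * K)) * M ^ (2 * j) := by
          rw [← Finset.sum_mul, ← truncMean, ← hM]; ring
      _ ≤ K * M ^ 2 * M ^ (2 * j) := by gcongr
      _ = K * M ^ (2 * (j + 1)) := by ring

/-- The second moment method: the expectation of `truncPop ^ 2 / flowEnergy` is at least
`E[truncPop] ^ 2 / E[flowEnergy]`. -/
theorem inv_le_lintegral_escapeBound (hZ : IsOffspringFamily P Z m) (lam : ℝ≥0) (N : ℕ)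
    {M K : ℝ≥0} (hM : truncMean P Z N = M) (hM0 : M ≠ 0) (hK0 : K ≠ 0) (j : ℕ) (v : Vertex)
    (hE : ∫⁻ ω, (flowEnergy lam N (fun u => Z u ω) j v : ℝ≥0∞) ∂P ≤ K * truncMean P Z N ^ (2 * j)) :
    ((K⁻¹ : ℝ≥0) : ℝ≥0∞) ≤ ∫⁻ ω, (escapeBound lam N (fun u => Z u ω) j v : ℝ≥0∞) ∂P := by
  -- `2 t θ ≤ θ ^ 2 / E + t ^ 2 E` is integrated for the optimal constant `t`
  set t : ℝ≥0 := (M ^ j)⁻¹ * K⁻¹ with ht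
  have hpt : ∀ ω, 2 * t * truncPop N (fun u => Z u ω) j v ≤
      escapeBound lam N (fun u => Z u ω) j v + t ^ 2 * flowEnergy lam N (fun u => Z u ω) j v := by
    intro ω
    have h1 := truncPop_sq_eq lam N (fun u => Z u ω) j v
    have h2 := truncPop_sq_le_flowEnergy lam N (fun u => Z u ω) j v
    set θ := truncPop N (fun u => Z u ω) j v
    set E := flowEnergy lam N (fun u => Z u ω) j v
    set b := escapeBound lam N (fun u => Z u ω) j v
    rcases eq_or_ne E 0 with h0 | h0
    · rw [h0, nonpos_iff_eq_zero, sq_eq_zero_iff] at h2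
      rw [h2, mul_zero]
      exact zero_le
    · rw [← mul_le_mul_iff_left₀ (pos_iff_ne_zero.2 h0), add_mul, ← h1]
      rw [← NNReal.coe_le_coe]
      push_cast
      nlinarith [sq_nonneg ((θ : ℝ) - t * E)]
  have hm1 : Measurable fun ω => (truncPop N (fun u => Z u ω) j v : ℝ≥0∞) :=
    (measurable_truncPop_offspringInfo Z N j v).mono (offspringInfo_le hZ.measurable _) le_rfl
  have hm2 : Measurable fun ω => (flowEnergy lam N (fun u => Z u ω) j v : ℝ≥0∞) :=
    (measurable_flowEnergy_offspringInfo Z lam N j v).mono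
      (offspringInfo_le hZ.measurable _) le_rfl
  have hint : ((2 * t : ℝ≥0) : ℝ≥0∞) * ∫⁻ ω, (truncPop N (fun u => Z u ω) j v : ℝ≥0∞) ∂P ≤
      ∫⁻ ω, (escapeBound lam N (fun u => Z u ω) j v : ℝ≥0∞) ∂P +
        ((t ^ 2 : ℝ≥0) : ℝ≥0∞) *
          ∫⁻ ω, (flowEnergy lam N (fun u => Z u ω) j v : ℝ≥0∞) ∂P := by
    rw [← lintegral_const_mul _ hm1, ← lintegral_const_mul _ hm2,
      ← lintegral_add_right _ (hm2.const_mul _)]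
    refine lintegral_mono fun ω => ?_
    simpa only [ENNReal.coe_mul, ENNReal.coe_add] using ENNReal.coe_le_coe.2 (hpt ω)
  rw [lintegral_truncPop hZ] at hint
  replace hint := hint.trans (add_le_add_right (mul_le_mul_right hE _) _)
  rw [hM] at hint
  have e1 : ((2 * t : ℝ≥0) : ℝ≥0∞) * (M : ℝ≥0∞) ^ j = (K⁻¹ : ℝ≥0) + (K⁻¹ : ℝ≥0) := by
    norm_cast
    rw [ht]
    field_simp
    norm_num
  have e2 : ((t ^ 2 : ℝ≥0) : ℝ≥0∞) * (K * (M : ℝ≥0∞) ^ (2 * j)) = (K⁻¹ : ℝ≥0) := by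
    norm_cast
    rw [ht]
    field_simp
    ring
  rw [e1, e2] at hint
  exact ENNReal.le_of_add_le_add_right ENNReal.coe_ne_top hint

/-- If `lam < m`, then the escape probabilities from the vertices have expectations bounded
away from zero, uniformly in the number of generations. -/
theorem exists_lintegral_escapeBound_ge (hZ : IsOffspringFamily P Z m) (hm : 1 < m) (lam : ℝ≥0)
    (hlm : lam < m) : ∃ N : ℕ, ∃ c : ℝ≥0, 0 < c ∧ ∀ j v,
      (c : ℝ≥0∞) ≤ ∫⁻ ω, (escapeBound lam N (fun u => Z u ω) j v : ℝ≥0∞) ∂P := by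
  have hlt : max 1 (lam : ℝ≥0∞) < ∑' i, P {ω | i < Z [] ω} := by
    rw [tsum_measure_lt_offspring hZ]
    refine max_lt ?_ ?_
    · rwa [← ENNReal.ofReal_one, ENNReal.ofReal_lt_ofReal_iff (by linarith)]
    · rw [ENNReal.lt_ofReal_iff_toReal_lt ENNReal.coe_ne_top]
      exact hlm
  rw [ENNReal.tsum_eq_iSup_nat] at hlt
  obtain ⟨N, hN⟩ := lt_iSup_iff.1 hlt
  rw [← truncMean] at hN
  have hfin : truncMean P Z N ≠ ∞ := ENNReal.sum_ne_top.2 fun i _ => measure_ne_top P _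
  obtain ⟨M, hM⟩ : ∃ M : ℝ≥0, (M : ℝ≥0∞) = truncMean P Z N := ⟨_, ENNReal.coe_toNNReal hfin⟩
  rw [← hM, max_lt_iff] at hN
  obtain ⟨h1, h2⟩ := hN
  replace h1 : 1 < M := by exact_mod_cast h1
  replace h2 : lam < M := by exact_mod_cast h2
  have h1' : (1 : ℝ) < M := h1
  have h2' : (lam : ℝ) < M := h2
  have hd1 : M < M ^ 2 := by nlinarith
  have hd2 : lam * M < M ^ 2 := by
    rw [sq]; exact mul_lt_mul_of_pos_right h2 (by positivity)
  -- any `C` and `K` beyond the two quotients below satisfy the recursive inequalities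
  set C : ℝ≥0 := max 1 ((N : ℝ≥0) ^ 2 / (M ^ 2 - M)) with hC
  set K : ℝ≥0 := max 1 (C * M ^ 2 / (M ^ 2 - lam * M)) with hK
  have hCM : C * M + (N : ℝ≥0) ^ 2 ≤ C * M ^ 2 := by
    have h3 : (N : ℝ≥0) ^ 2 ≤ C * (M ^ 2 - M) :=
      (div_le_iff₀ (tsub_pos_of_lt hd1)).1 (le_max_right _ _)
    calc C * M + (N : ℝ≥0) ^ 2 ≤ C * M + C * (M ^ 2 - M) := by gcongr
      _ = C * M ^ 2 := by rw [← mul_add, add_tsub_cancel_of_le hd1.le]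
  have hKM : C * M ^ 2 + lam * (M * K) ≤ K * M ^ 2 := by
    have h3 : C * M ^ 2 ≤ K * (M ^ 2 - lam * M) :=
      (div_le_iff₀ (tsub_pos_of_lt hd2)).1 (le_max_right _ _)
    calc C * M ^ 2 + lam * (M * K) ≤ K * (M ^ 2 - lam * M) + K * (lam * M) := by
          rw [← mul_assoc, mul_comm _ K]; gcongr
      _ = K * M ^ 2 := by rw [← mul_add, tsub_add_cancel_of_le hd2.le]
  have hK1 : 1 ≤ K := le_max_left _ _
  have hC1 : 1 ≤ C := le_max_left _ _
  refine ⟨N, K⁻¹, by positivity, fun j v => ?_⟩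
  refine inv_le_lintegral_escapeBound hZ lam N hM.symm (by positivity) (by positivity) j v
    (lintegral_flowEnergy_le hZ lam N (C := C) (K := K) ?_ ?_ ?_ ?_ j v)
  · exact_mod_cast hC1
  · rw [← hM]; exact_mod_cast hCM
  · exact_mod_cast hK1
  · rw [← hM]; exact_mod_cast hKM

end Moments

/-! ### Weak bias: transience -/

section Transience

/-- One step of the walk from a vertex other than the root is bounded below by the
contributions of the parent and of the children. -/
theorem step_le_tsum (lam : ℝ) (z : Vertex → ℕ) (a : ℕ) (u : Vertex) (φ : Vertex → ℝ≥0∞) :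
    ENNReal.ofReal (lam / (lam + numChildren (familyTree z) (a :: u))) * φ u +
      ∑ i ∈ Finset.range (numChildren (familyTree z) (a :: u)),
        ENNReal.ofReal (1 / (lam + numChildren (familyTree z) (a :: u))) * φ (i :: a :: u) ≤
      ∑' w, ENNReal.ofReal (stepProb lam (familyTree z) (a :: u) w) * φ w := by
  have hinj : Function.Injective fun i : ℕ => (i :: a :: u : Vertex) :=
    fun i j h => (List.cons.inj h).1
  set s := (Finset.range (numChildren (familyTree z) (a :: u))).map ⟨_, hinj⟩ with hs
  have hu : u ∉ s := by
    simp only [hs, Finset.mem_map, not_exists, not_and]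
    exact fun i _ h => cons_cons_ne a i u h
  refine le_trans (le_of_eq ?_) (ENNReal.sum_le_tsum (insert u s))
  rw [Finset.sum_insert hu, stepProb_parent, hs, Finset.sum_map]
  congr 1
  refine Finset.sum_congr rfl fun i hi => ?_
  rw [← stepProb_child lam (cons_mem_iff_lt_numChildren.2 (Finset.mem_range.1 hi))]
  rfl

/-- `climbBound`, set to zero beyond level `k`. Since the walk is at level at most `k` at time `k`,
this loses nothing, and makes sure that the walk stays where `climbBound` is subharmonic. -/
noncomputable def cutClimbBound (lam : ℝ≥0) (N : ℕ) (y : Vertex → ℕ) (n k : ℕ) (v : Vertex) :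
    ℝ≥0∞ :=
  if v.length ≤ k then (climbBound lam N y n v : ℝ≥0∞) else 0

theorem cutClimbBound_nil (lam : ℝ≥0) (N : ℕ) (y : Vertex → ℕ) (n k : ℕ) :
    cutClimbBound lam N y n k [] = 0 := by
  simp [cutClimbBound, climbBound]

theorem cutClimbBound_le_one (lam : ℝ≥0) (N : ℕ) (y : Vertex → ℕ) (n k : ℕ) (v : Vertex) :
    cutClimbBound lam N y n k v ≤ 1 := by
  unfold cutClimbBound
  split_ifs
  · exact_mod_cast climbBound_le_one lam N y n v
  · exact zero_le

theorem cutClimbBound_le_tsum {lam : ℝ≥0} (hlam : 0 < lam) (N : ℕ) (z : Vertex → ℕ) {n k : ℕ}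
    (hk : k < n) {v : Vertex} (hv : v ≠ []) :
    cutClimbBound lam N (numChildren (familyTree z)) n k v ≤
      ∑' w, ENNReal.ofReal (stepProb lam (familyTree z) v w) *
        cutClimbBound lam N (numChildren (familyTree z)) n (k + 1) w := by
  obtain ⟨a, u, rfl⟩ := List.exists_cons_of_ne_nil hv
  set y := numChildren (familyTree z) with hy
  by_cases hl : (a :: u).length ≤ k
  · refine le_trans ?_ (step_le_tsum lam z a u _)
    have hl' : u.length + 1 ≤ k := by simpa using hl
    have h0 : lam + (y (a :: u) : ℝ≥0) ≠ 0 := by positivity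
    have e1 : ENNReal.ofReal ((lam : ℝ) / (lam + y (a :: u))) =
        ((lam / (lam + y (a :: u)) : ℝ≥0) : ℝ≥0∞) := by
      rw [← ENNReal.ofReal_coe_nnreal]; push_cast; rfl
    have e2 : ENNReal.ofReal (1 / ((lam : ℝ) + y (a :: u))) =
        ((1 / (lam + y (a :: u)) : ℝ≥0) : ℝ≥0∞) := by
      rw [← ENNReal.ofReal_coe_nnreal]; push_cast; rfl
    have e3 : ∀ i : ℕ, (i :: a :: u : Vertex).length ≤ k + 1 := fun i => by simpa using hl'
    simp only [cutClimbBound, if_pos hl, if_pos (e3 _), if_pos (show u.length ≤ k + 1 by omega)]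
    rw [← hy, e1, e2, ← Finset.mul_sum]
    simp only [← ENNReal.coe_mul, ← ENNReal.coe_add, ← ENNReal.ofNNReal_finsetSum,
      ENNReal.coe_le_coe]
    have key := climbBound_subharmonic lam N y n a u (lt_of_le_of_lt hl hk)
    rw [div_mul_eq_mul_div, div_mul_eq_mul_div, one_mul, ← add_div,
      le_div_iff₀ (pos_iff_ne_zero.2 h0), mul_comm]
    exact key
  · rw [cutClimbBound, if_neg hl]
    exact zero_le

variable {Ω : Type*} {Z : Vertex → Ω → ℕ}

theorem measurable_cutClimbBound (lam : ℝ≥0) (N n k : ℕ) (v : Vertex) :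
    Measurable[treeInfo (randomTree Z)]
      fun ω => cutClimbBound lam N (numChildren (randomTree Z ω)) n k v :=
  Measurable.ite (MeasurableSet.const _)
    (measurable_climbBound lam N n (mΩ := treeInfo (randomTree Z))
      (Y := fun u ω => numChildren (randomTree Z ω) u)
      (@measurable_numChildren Ω (treeInfo (randomTree Z)) Z (measurableSet_treeInfo _))
      v).coe_nnreal_ennreal measurable_const

variable [mΩ : MeasurableSpace Ω] {P : Measure Ω} [IsProbabilityMeasure P]
  {m : ℝ} {lam : ℝ≥0} {X : ℕ → Ω → Vertex}

theorem lintegral_cutClimbBound_succ (h : ∀ v, MeasurableSet {ω | v ∈ randomTree Z ω})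
    (hX : IsBiasedWalk P lam (randomTree Z) X) (N n k : ℕ) :
    ∫⁻ ω, (awayUpTo X (k + 1)).indicator (fun ω =>
        cutClimbBound lam N (numChildren (randomTree Z ω)) n (k + 1) (X (k + 1) ω)) ω ∂P =
      ∫⁻ ω, (awayUpTo X k).indicator (fun ω =>
        ∑' w, ENNReal.ofReal (stepProb lam (randomTree Z ω) (X k ω) w) *
          cutClimbBound lam N (numChildren (randomTree Z ω)) n (k + 1) w) ω ∂P := by
  have key := lintegral_step lam.2 h hX k (φ := fun w => (awayUpTo X k).indicator fun ω =>
    cutClimbBound lam N (numChildren (randomTree Z ω)) n (k + 1) w) fun w =>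
      ((measurable_cutClimbBound lam N n (k + 1) w).mono (treeInfo_le_history _ X k)
        le_rfl).indicator (measurableSet_awayUpTo (randomTree Z) X k)
  convert key using 2
  · ext ω
    by_cases hω : ω ∈ awayUpTo X k
    · by_cases h0 : X (k + 1) ω = []
      · rw [Set.indicator_of_notMem fun h' => (mem_awayUpTo_succ.1 h').2 h0,
          Set.indicator_of_mem hω, h0, cutClimbBound_nil]
      · rw [Set.indicator_of_mem (mem_awayUpTo_succ.2 ⟨hω, h0⟩), Set.indicator_of_mem hω]
    · rw [Set.indicator_of_notMem fun h' => hω (mem_awayUpTo_succ.1 h').1,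
        Set.indicator_of_notMem hω]
  · ext ω
    by_cases hω : ω ∈ awayUpTo X k
    · simp only [Set.indicator_of_mem hω]; rfl
    · simp only [Set.indicator_of_notMem hω, mul_zero, tsum_zero]

/-- Before its return to the root, the walk makes `climbBound` a submartingale. Hence the
probability that it has not returned by time `n` is at least the mean of `climbBound` after the
first step, of which only the contribution of the first child of the root is kept. -/
theorem lintegral_le_measure_awayUpTo (hlam : 0 < lam)
    (h : ∀ v, MeasurableSet {ω | v ∈ randomTree Z ω})
    (hX : IsBiasedWalk P lam (randomTree Z) X) (N : ℕ) {n : ℕ} (hn : 1 ≤ n) :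
    ∫⁻ ω, ENNReal.ofReal (stepProb lam (randomTree Z ω) [] [0]) *
      climbBound lam N (numChildren (randomTree Z ω)) n [0] ∂P ≤ P (awayUpTo X n) := by
  set U : ℕ → ℝ≥0∞ := fun k => ∫⁻ ω, (awayUpTo X k).indicator (fun ω =>
    cutClimbBound lam N (numChildren (randomTree Z ω)) n k (X k ω)) ω ∂P with hU
  have hmono : ∀ k, 1 ≤ k → k ≤ n → U 1 ≤ U k := by
    intro k hk
    induction k, hk using Nat.le_induction with
    | base => exact fun _ => le_rfl
    | succ k hk ih =>
      intro hkn
      refine (ih (by omega)).trans ?_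
      simp only [hU]
      rw [lintegral_cutClimbBound_succ h hX]
      refine lintegral_mono fun ω => Set.indicator_le_indicator' fun hω => ?_
      exact cutClimbBound_le_tsum hlam N _ (by omega) (hω k hk le_rfl)
  have hfirst : ∫⁻ ω, ENNReal.ofReal (stepProb lam (randomTree Z ω) [] [0]) *
      climbBound lam N (numChildren (randomTree Z ω)) n [0] ∂P ≤ U 1 := by
    simp only [hU]
    rw [lintegral_cutClimbBound_succ h hX]
    refine lintegral_mono_ae ?_
    filter_upwards [hX.start] with ω hω
    rw [awayUpTo_zero, Set.indicator_univ, hω]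
    refine le_trans (le_of_eq ?_) (ENNReal.le_tsum [0])
    simp [cutClimbBound]
  refine hfirst.trans ((hmono n hn le_rfl).trans ?_)
  rw [← lintegral_indicator_one (history_le h hX n _ (measurableSet_awayUpTo (randomTree Z) X n))]
  exact lintegral_mono fun ω =>
    Set.indicator_le_indicator (cutClimbBound_le_one lam N _ n n (X n ω))

/-- The probability of stepping from the root to its first child is positive. -/
theorem lintegral_inv_offspring_pos (hZ : IsOffspringFamily P Z m) (hm : 0 < m) :
    0 < ∫⁻ ω, (if 0 < Z [] ω then ENNReal.ofReal (1 / (Z [] ω : ℝ)) else 0) ∂P := by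
  have hmeas : Measurable fun ω => if 0 < Z [] ω then ENNReal.ofReal (1 / (Z [] ω : ℝ)) else 0 :=
    (measurable_from_top (f := fun k : ℕ => if 0 < k then ENNReal.ofReal (1 / (k : ℝ)) else 0)).comp
      (hZ.measurable [])
  rw [pos_iff_ne_zero]
  intro h0
  rw [lintegral_eq_zero_iff hmeas] at h0
  have h1 : ∫⁻ ω, (Z [] ω : ℝ≥0∞) ∂P = 0 := by
    rw [lintegral_congr_ae (g := fun _ => 0)]
    · simp
    · filter_upwards [h0] with ω hω
      by_contra hne
      have hpos : 0 < Z [] ω := Nat.pos_of_ne_zero fun h' => hne (by simp [h'])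
      have hpos' : (0 : ℝ) < 1 / (Z [] ω : ℝ) := by positivity
      simp only [if_pos hpos, Pi.zero_apply, ENNReal.ofReal_eq_zero] at hω
      exact absurd hω (not_le.2 hpos')
  rw [lintegral_offspring hZ, ENNReal.ofReal_eq_zero] at h1
  exact absurd h1 (not_le.2 hm)

theorem isTransient_of_lt_mean (hlam : 0 < lam) (hm : 1 < m) (hlm : lam < m)
    (hZ : IsOffspringFamily P Z m) (hX : IsBiasedWalk P lam (randomTree Z) X) :
    IsTransient P X := by
  have h := measurableSet_mem_randomTree hZ.measurable
  obtain ⟨N, c, hc, hesc⟩ := exists_lintegral_escapeBound_ge hZ hm lam hlm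
  set p : Ω → ℝ≥0∞ := fun ω => if 0 < Z [] ω then ENNReal.ofReal (1 / (Z [] ω : ℝ)) else 0 with hp
  have hpm : Measurable[offspringInfo Z {[]}] p :=
    (measurable_from_top (f := fun k : ℕ => if 0 < k then ENNReal.ofReal (1 / (k : ℝ)) else 0)).comp
      (measurable_offspringInfo Z (S := {[]}) rfl)
  set κ : ℝ≥0∞ := (∫⁻ ω, p ω ∂P) * c with hκ
  have hκpos : 0 < κ :=
    ENNReal.mul_pos (lintegral_inv_offspring_pos hZ (by linarith)).ne'
      (by exact_mod_cast hc.ne')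
  have hbound : ∀ n, κ ≤ P (awayUpTo X (n + 1)) := by
    intro n
    have hem : Measurable[offspringInfo Z (descendants [0])] fun ω =>
        (escapeBound lam N (fun u => Z u ω) n [0] : ℝ≥0∞) :=
      (measurable_escapeBound (mΩ := offspringInfo Z (descendants [0])) lam N n fun _ hu =>
        measurable_offspringInfo Z hu).coe_nnreal_ennreal
    calc κ ≤ (∫⁻ ω, p ω ∂P) *
          ∫⁻ ω, (escapeBound lam N (fun u => Z u ω) n [0] : ℝ≥0∞) ∂P :=
          mul_le_mul' le_rfl (hesc n [0])
      _ = ∫⁻ ω, p ω * escapeBound lam N (fun u => Z u ω) n [0] ∂P :=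
          (lintegral_mul_of_disjoint hZ (disjoint_singleton_descendants 0 []) hpm hem).symm
      _ ≤ ∫⁻ ω, ENNReal.ofReal (stepProb lam (randomTree Z ω) [] [0]) *
          climbBound lam N (numChildren (randomTree Z ω)) (n + 1) [0] ∂P := by
          refine lintegral_mono fun ω => ?_
          by_cases h0 : 0 < Z [] ω
          · have hmem : [0] ∈ familyTree fun v => Z v ω := cons_mem_familyTree.2 ⟨trivial, h0⟩
            have hroot : [] ∈ familyTree fun v => Z v ω := trivial
            simp only [hp, if_pos h0, randomTree]
            rw [stepProb_root_child _ hmem, numChildren_of_mem hroot]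
            simp only [climbBound, mul_zero, add_zero, List.length_nil, zero_add,
              Nat.add_sub_cancel, escapeBound, truncPop_numChildren _ _ hmem,
              flowEnergy_numChildren _ _ _ hmem]
            exact le_rfl
          · simp only [hp, if_neg h0, zero_mul]
            exact zero_le
      _ ≤ P (awayUpTo X (n + 1)) := lintegral_le_measure_awayUpTo hlam h hX N (by omega)
  have hset : {ω | returnTime X ω = ⊤} = ⋂ k, awayUpTo X k := by
    ext ω
    rw [Set.mem_iInter]
    exact returnTime_eq_top_iff
  rw [IsTransient, hset, (awayUpTo_antitone X).measure_iInter
    (fun k => (history_le h hX k _ (measurableSet_awayUpTo (randomTree Z) X k)).nullMeasurableSet)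
    ⟨0, measure_ne_top P _⟩]
  exact hκpos.trans_le (le_iInf fun k =>
    (hbound k).trans (measure_mono (awayUpTo_antitone X (Nat.le_succ k))))

end Transience

end BiasedWalk

theorem theorem1 {Ω : Type*} [MeasurableSpace Ω] (P : Measure Ω) [IsProbabilityMeasure P]
    (m lam : ℝ) (hm : 1 < m) (hlam : 0 < lam)
    (Z : BiasedWalk.Vertex → Ω → ℕ) (hZ : BiasedWalk.IsOffspringFamily P Z m)
    (X : ℕ → Ω → BiasedWalk.Vertex)
    (hX : BiasedWalk.IsBiasedWalk P lam (BiasedWalk.randomTree Z) X) :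
    (lam < m → BiasedWalk.IsTransient P X) ∧
      (m < lam → BiasedWalk.IsPositiveRecurrent P X) := by
  refine ⟨fun h => ?_, fun h => ?_⟩
  · lift lam to NNReal using hlam.le
    exact BiasedWalk.isTransient_of_lt_mean (by exact_mod_cast hlam) hm h hZ hX
  · exact BiasedWalk.isPositiveRecurrent_of_mean_lt hlam (by linarith) h hZ hX
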